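/- Let $\mathbb{G}$ be a commutative one-dimensional formal group over a formal scheme $S$, with a coordinate $x$, so that $\mathcal{O}_{\mathbb{G}}=k[[x]]$ where $k=\mathcal{O}_S$ is a commutative ring. (Only the ring $k$ and the coordinate $x$ enter below.) Let $d_0,d_1,r\ge 0$ be integers with $r\le\min(d_0,d_1)$. The scheme $\mathrm{Div}_d^+$ of divisors of degree $d$ on $\mathbb{G}$ has coordinate ring $k[[c_1,\dots,c_d]]$, and its tautological divisor has equation $x^d+c_1x^{d-1}+\dots+c_d$. Put $R=\mathcal{O}_{\mathrm{Div}_{d_0}^+\times\mathrm{Div}_{d_1}^+}=k[[c_{01},\dots,c_{0d_0},c_{11},\dots,c_{1d_1}]]$, with tautological equations $f_i(x)=x^{d_i}+\sum_{j=1}^{d_i}c_{ij}x^{d_i-j}$ for $i=0,1$. For a finitely generated module $M$ over a commutative ring, let $I_j(M)$ be its $j$-th Fitting ideal: for any choice of $n$ generators of $M$, it is generated by the $(n-j)\times(n-j)$ minors of the matrices of relations between them (with $I_{-1}(M)=0$). Let $\mathrm{Int}_r(d_0,d_1)$ be the scheme of pairs $(D_0,D_1)$ of divisors of degrees $d_0,d_1$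 with intersection multiplicity at least $r$, that is, the closed subscheme of $\mathrm{Div}_{d_0}^+\times\mathrm{Div}_{d_1}^+$ with $$\mathcal{O}_{\mathrm{Int}_r(d_0,d_1)}=R/I_{r-1}\bigl(R[[x]]/(f_0,f_1)\bigr).$$ Let $\mathrm{Sub}_r(d_0,d_1)$ be the scheme of triples $(D,D_0,D_1)$ of divisors of degrees $r,d_0,d_1$ with $D\le D_0$ and $D\le D_1$; its coordinate ring is the quotient of $R[[c_1,\dots,c_r]]$ by the ideal generated by the coefficients of the remainders of $f_0$ and $f_1$ on division by $h(x)=x^r+c_1x^{r-1}+\dots+c_r$. Then: 1. $\mathcal{O}_{\mathrm{Int}_r(d_0,d_1)}$ is a free module over $k[[c_{0i}\mid 0<i\le d_0-r]]\,[[c_{1j}\mid 0<j\le d_1]]$, with basis the family of the (images of the) monomials $\prod_{i=d_0-r+1}^{d_0}c_{0i}^{\alpha_i}$ with $\alpha_i\ge 0$ and $\sum_i\alpha_i\le d_1-r$. 2. The ring map $R\to\mathcal{O}_{\mathrm{Sub}_r(d_0,d_1)}$ given by $(D,D_0,D_1)\mapsto(D_0,D_1)$ factors through a ring map $\pi^*:\mathcal{O}_{\mathrm{Int}_r(d_0,d_1)}\to\mathcal{O}_{\mathrm{Sub}_r(d_0,d_1)}$,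 and $\pi^*$ is a split monomorphism of modules over $\mathcal{O}_{\mathrm{Div}_{d_1}^+}=k[[c_{11},\dots,c_{1d_1}]]$: it has a left inverse that is linear over this ring. In particular $\pi^*$ is injective, i.e. $\pi:\mathrm{Sub}_r(d_0,d_1)\to\mathrm{Int}_r(d_0,d_1)$ is dominant. -/

import Mathlib

open Polynomial

noncomputable section

namespace DivisorIntersection

/-- The `j`-th Fitting ideal `I_j(M)` of a finitely generated module `M`: if `M` is generated by
`n` elements, it is generated by the minors of size `n - j` of the matrices whose rows are
relations between these generators.  All finite generating families are allowed at once; the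
classical invariance theorem says that any single one of them gives the same ideal. -/
def fittingIdeal (R : Type*) [CommRing R] (M : Type*) [AddCommGroup M] [Module R M] (j : ℤ) :
    Ideal R :=
  Ideal.span {a | ∃ (n s : ℕ) (e : Fin n → M) (w : Fin s → Fin n → R) (c : Fin s → Fin n),
    Submodule.span R (Set.range e) = ⊤ ∧
    (∀ i, ∑ t, w i t • e t = 0) ∧
    (s : ℤ) + j = n ∧
    a = (Matrix.of fun p q => w p (c q)).det}

/-- The monic polynomial `x ^ d + c_1 x ^ (d - 1) + ... + c_d`; the entry `c i` of the family is
the coefficient called `c_{i + 1}`. -/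
def monicPoly {A : Type*} [CommRing A] (d : ℕ) (c : Fin d → A) : A[X] :=
  X ^ d + ∑ i : Fin d, C (c i) * X ^ (d - 1 - (i : ℕ))

theorem monicPoly_monic {A : Type*} [CommRing A] (d : ℕ) (c : Fin d → A) :
    (monicPoly d c).Monic := by
  rcases subsingleton_or_nontrivial A with hA | hA
  · exact Subsingleton.elim _ _
  refine monic_X_pow_add ?_
  refine (degree_sum_le _ _).trans_lt ?_
  rw [Finset.sup_lt_iff (by exact_mod_cast WithBot.bot_lt_coe d)]
  intro i _
  refine (degree_C_mul_X_pow_le _ _).trans_lt ?_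
  have := i.isLt
  exact_mod_cast (by omega : d - 1 - (i : ℕ) < d)

/-- The coordinate ring `R⟦x⟧ / (f₀, f₁)` of the intersection `D₀ ∩ D₁` of the divisors with
equations `f₀` and `f₁`. -/
abbrev InterRing {R : Type*} [CommRing R] (f₀ f₁ : R[X]) : Type _ :=
  PowerSeries R ⧸ Ideal.span {(f₀ : PowerSeries R), (f₁ : PowerSeries R)}

/-- The ideal `I_{r-1}` of the base ring that cuts out the closed subscheme over which the
intersection multiplicity (Fitting rank) of `D₀` and `D₁` is at least `r`. -/
def intIdeal {R : Type*} [CommRing R] (f₀ f₁ : R[X]) (r : ℕ) : Ideal R :=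
  fittingIdeal R (InterRing f₀ f₁) ((r : ℤ) - 1)

/-- The ideal of the base ring that cuts out the closed subscheme over which the divisor with
equation `h` is contained in the divisor with equation `f`, that is, `h` divides `f`. -/
def leIdeal {A : Type*} [CommRing A] (h f : A[X]) : Ideal A :=
  Ideal.span (Set.range (f %ₘ h).coeff)

theorem leIdeal_le_ker_iff {A B : Type*} [CommRing A] [CommRing B] (φ : A →+* B) {h f : A[X]}
    (hh : h.Monic) : leIdeal h f ≤ RingHom.ker φ ↔ h.map φ ∣ f.map φ := by
  rw [← Polynomial.modByMonic_eq_zero_iff_dvd (hh.map φ), ← Polynomial.map_modByMonic φ hh,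
    leIdeal, Ideal.span_le, Polynomial.ext_iff]
  constructor
  · intro H n
    simpa using H ⟨n, rfl⟩
  · rintro H _ ⟨n, rfl⟩
    simpa using H n

/-- The coordinate ring `k⟦c_1, ..., c_d⟧` of the scheme of divisors of degree `d` on the formal
group with coordinate `x` over a base with ring of functions `k`. -/
abbrev DivRing (k : Type*) [CommRing k] (d : ℕ) : Type _ := MvPowerSeries (Fin d) k

/-- The coordinate ring `k⟦c_{01}, ..., c_{0d₀}, c_{11}, ..., c_{1d₁}⟧` of the scheme of pairs
`(D₀, D₁)` of divisors of degrees `d₀` and `d₁`. -/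
abbrev DivPairRing (k : Type*) [CommRing k] (d₀ d₁ : ℕ) : Type _ :=
  MvPowerSeries (Fin d₀ ⊕ Fin d₁) k

/-- The coordinate ring of the scheme of triples `(D, D₀, D₁)` of divisors of degrees `r`, `d₀`
and `d₁`. -/
abbrev DivTripleRing (k : Type*) [CommRing k] (d₀ d₁ r : ℕ) : Type _ :=
  MvPowerSeries (Fin r ⊕ (Fin d₀ ⊕ Fin d₁)) k

/-- The equation of the tautological divisor `D₀` over the scheme of pairs. -/
def pairPoly₀ (k : Type*) [CommRing k] (d₀ d₁ : ℕ) : (DivPairRing k d₀ d₁)[X] :=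
  monicPoly d₀ fun i => MvPowerSeries.X (Sum.inl i)

/-- The equation of the tautological divisor `D₁` over the scheme of pairs. -/
def pairPoly₁ (k : Type*) [CommRing k] (d₀ d₁ : ℕ) : (DivPairRing k d₀ d₁)[X] :=
  monicPoly d₁ fun j => MvPowerSeries.X (Sum.inr j)

/-- The projection `(D, D₀, D₁) ↦ (D₀, D₁)` on coordinate rings. -/
def pairToTriple (k : Type*) [CommRing k] (d₀ d₁ r : ℕ) :
    DivPairRing k d₀ d₁ →ₐ[k] DivTripleRing k d₀ d₁ r :=
  MvPowerSeries.rename Sum.inr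

/-- The equation of the tautological divisor `D` over the scheme of triples. -/
def triplePoly (k : Type*) [CommRing k] (d₀ d₁ r : ℕ) : (DivTripleRing k d₀ d₁ r)[X] :=
  monicPoly r fun i => MvPowerSeries.X (Sum.inl i)

/-- The coordinate ring of `Int_r(d₀, d₁)`, the scheme of pairs of divisors of degrees `d₀` and
`d₁` whose intersection multiplicity is at least `r`. -/
def IntRing (k : Type*) [CommRing k] (d₀ d₁ r : ℕ) : Type _ :=
  DivPairRing k d₀ d₁ ⧸ intIdeal (pairPoly₀ k d₀ d₁) (pairPoly₁ k d₀ d₁) r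

instance (k : Type*) [CommRing k] (d₀ d₁ r : ℕ) : CommRing (IntRing k d₀ d₁ r) :=
  inferInstanceAs
    (CommRing (DivPairRing k d₀ d₁ ⧸ intIdeal (pairPoly₀ k d₀ d₁) (pairPoly₁ k d₀ d₁) r))

/-- The quotient map onto the coordinate ring of `Int_r(d₀, d₁)`. -/
def intMk (k : Type*) [CommRing k] (d₀ d₁ r : ℕ) : DivPairRing k d₀ d₁ →+* IntRing k d₀ d₁ r :=
  Ideal.Quotient.mk (intIdeal (pairPoly₀ k d₀ d₁) (pairPoly₁ k d₀ d₁) r)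

/-- The ideal expressing the conditions `D ≤ D₀` and `D ≤ D₁` on a triple `(D, D₀, D₁)`. -/
def subIdeal (k : Type*) [CommRing k] (d₀ d₁ r : ℕ) : Ideal (DivTripleRing k d₀ d₁ r) :=
  leIdeal (triplePoly k d₀ d₁ r)
      ((pairPoly₀ k d₀ d₁).map (pairToTriple k d₀ d₁ r).toRingHom) ⊔
    leIdeal (triplePoly k d₀ d₁ r)
      ((pairPoly₁ k d₀ d₁).map (pairToTriple k d₀ d₁ r).toRingHom)

/-- The coordinate ring of `Sub_r(d₀, d₁)`, the scheme of triples `(D, D₀, D₁)` of divisors of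
degrees `r`, `d₀`, `d₁` with `D ≤ D₀` and `D ≤ D₁`. -/
def SubRing (k : Type*) [CommRing k] (d₀ d₁ r : ℕ) : Type _ :=
  DivTripleRing k d₀ d₁ r ⧸ subIdeal k d₀ d₁ r

instance (k : Type*) [CommRing k] (d₀ d₁ r : ℕ) : CommRing (SubRing k d₀ d₁ r) :=
  inferInstanceAs (CommRing (DivTripleRing k d₀ d₁ r ⧸ subIdeal k d₀ d₁ r))

/-- The quotient map onto the coordinate ring of `Sub_r(d₀, d₁)`. -/
def subMk (k : Type*) [CommRing k] (d₀ d₁ r : ℕ) :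
    DivTripleRing k d₀ d₁ r →+* SubRing k d₀ d₁ r :=
  Ideal.Quotient.mk (subIdeal k d₀ d₁ r)

/-- The power series ring `k⟦c_{0i} | 0 < i ≤ d₀ - r⟧⟦c_{1j} | 0 < j ≤ d₁⟧`. -/
abbrev CoeffRing (k : Type*) [CommRing k] (d₀ d₁ r : ℕ) : Type _ :=
  MvPowerSeries (Fin (d₀ - r) ⊕ Fin d₁) k

/-- The inclusion of `k⟦c_{0i} | 0 < i ≤ d₀ - r⟧⟦c_{1j} | 0 < j ≤ d₁⟧` in the coordinate ring of
the scheme of pairs. -/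
def coeffToPair (k : Type*) [CommRing k] (d₀ d₁ r : ℕ) :
    CoeffRing k d₀ d₁ r →ₐ[k] DivPairRing k d₀ d₁ :=
  MvPowerSeries.rename (Sum.map (Fin.castLE (Nat.sub_le d₀ r)) id)

/-- The projection `(D₀, D₁) ↦ D₁` on coordinate rings. -/
def divToPair (k : Type*) [CommRing k] (d₀ d₁ : ℕ) : DivRing k d₁ →ₐ[k] DivPairRing k d₀ d₁ :=
  MvPowerSeries.rename Sum.inr

instance (k : Type*) [CommRing k] (d₀ d₁ r : ℕ) :
    Algebra (CoeffRing k d₀ d₁ r) (IntRing k d₀ d₁ r) :=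
  ((intMk k d₀ d₁ r).comp (coeffToPair k d₀ d₁ r).toRingHom).toAlgebra

instance (k : Type*) [CommRing k] (d₀ d₁ r : ℕ) : Algebra (DivRing k d₁) (IntRing k d₀ d₁ r) :=
  ((intMk k d₀ d₁ r).comp (divToPair k d₀ d₁).toRingHom).toAlgebra

instance (k : Type*) [CommRing k] (d₀ d₁ r : ℕ) : Algebra (DivRing k d₁) (SubRing k d₀ d₁ r) :=
  ((subMk k d₀ d₁ r).comp
    ((pairToTriple k d₀ d₁ r).toRingHom.comp (divToPair k d₀ d₁).toRingHom)).toAlgebra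

/-- The image in the coordinate ring of `Int_r(d₀, d₁)` of the coefficient
`c_{0, d₀ - r + 1 + t}`, for `0 ≤ t < r`. -/
def topCoeff (k : Type*) [CommRing k] {d₀ r : ℕ} (d₁ : ℕ) (h : r ≤ d₀) (t : Fin r) :
    IntRing k d₀ d₁ r :=
  intMk k d₀ d₁ r (MvPowerSeries.X (Sum.inl ⟨d₀ - r + (t : ℕ), by omega⟩))

end DivisorIntersection

end

/-!
The proof confronts generators of the coordinate ring of `Int_r(d₀, d₁)` with functionals on the
coordinate ring of `Sub_r(d₀, d₁)`. Write `B` for the ring `k⟦c_{0i} | i ≤ d₀ - r⟧⟦c_{1j}⟧` and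
`mon α` for the monomials of degree at most `d₁ - r` in the remaining coefficients of `f₀`.

*Generators.* The powers `1, x, ..., x ^ (d₁ - 1)` generate `R⟦x⟧ / (f₀, f₁)`, and the remainders of
`x ^ p * f₀` on division by `f₁` are relations between them; their minors of size `d₁ - r + 1` lie
in the Fitting ideal. Modulo the variables of `B` these relations form a band matrix with the
coefficients of `f₀` as entries. The diagonal product of a minor of a band matrix has the least sum
of squares of indices among all products in its expansion, so every product of `d₁ - r + 1` of the
top coefficients vanishes or reduces to shorter ones (`prod_mem_closure_of_minors_eq_zero`,
`multiset_prod_mem_closure_card_lt`). Successive approximation lifts this to the statement that the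
`mon α` span over `B` (`exists_intMk_eq_sum`).

*The projection.* Over `𝒪(Sub_r)` the polynomial `h` of degree `r` divides `f₀` and `f₁`, so that the
base change of `R⟦x⟧ / (f₀, f₁)` maps onto a free module of rank `r`, the quotient by `h`. The minors
that define the Fitting ideal therefore vanish in `𝒪(Sub_r)`, and `R → 𝒪(Sub_r)` factors through
`π : 𝒪(Int_r) → 𝒪(Sub_r)` (`intIdeal_le_comap`).

*Functionals.* Let `E` be the `B`-algebra generated by `r` independent roots `x i` of `f₁`; it is
free on the monomials with exponents less than `d₁`. With `h = ∏ (X - x i)`, and `f₀` the multiple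
of `h` whose first coefficients are those in `B`, one gets a homomorphism `θ` to `E` from the ring
of triples. The differences of the `x i` are not units, and although `f₁` vanishes at every `x i`
it need not be divisible by `h`; but the Vandermonde determinant `V` kills the remainder. Thus each
coordinate of `V * θ` is a `B`-linear functional on `𝒪(Sub_r)` (`exists_functional`).

*The determinant.* Choosing for each `β` one exponent, `leadExponent β`, gives a square matrix
with entries in `B`, the values of the functionals on the `mon α`. Let `Δ` be its determinant. When
all variables except the last variable `y = c_{0, d₀ - r}` are put equal to zero, `V * θ (mon α)`
becomes a polynomial whose leading monomial, for a weight that prefers low degree, has exponent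
`leadExponent α` and coefficient `± y ^ |α|`. So the matrix is triangular and `Δ` becomes a power of
`y` up to sign (`associated_det_alternant`). By Weierstrass division in the variable `y`,
multiplication by `Δ` has a left inverse that is linear over `k⟦c_{1j}⟧`
(`exists_leftInverse_mul_det`); if `r = d₀`, then `Δ` is a unit.

*Conclusion.* Composing the functionals with the adjugate matrix and this left inverse yields maps
on `𝒪(Sub_r)`, linear over `k⟦c_{1j}⟧`, that return the coefficients `b α` of `π (∑ b α • mon α)`
(`exists_coordinates`). Therefore the `mon α` are independent, and `π` is split.
-/

namespace DivisorIntersection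

/-! ### Adic completeness and evaluation of power series -/

section Adic

theorem mem_smul_top_iff_repr {B E ι : Type*} [CommRing B] [AddCommGroup E] [Module B E]
    [Finite ι] (b : Module.Basis ι B E) (I : Ideal B) {x : E} :
    x ∈ (I • ⊤ : Submodule B E) ↔ ∀ i, b.repr x i ∈ I := by
  have := Fintype.ofFinite ι
  constructor
  · intro hx i
    induction hx using Submodule.smul_induction_on' with
    | smul r hr y _ => simpa using I.mul_mem_right _ hr
    | add y _ z _ hy hz => simpa using I.add_mem hy hz
  · intro h
    rw [← b.sum_repr x]
    exact Submodule.sum_mem _ fun i _ => Submodule.smul_mem_smul (h i) trivial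

theorem isAdicComplete_of_basis {B E ι : Type*} [CommRing B] [AddCommGroup E] [Module B E]
    [Finite ι] (b : Module.Basis ι B E) (I : Ideal B) [IsAdicComplete I B] :
    IsAdicComplete I E where
  haus' x hx := by
    refine b.repr.injective (Finsupp.ext fun i => ?_)
    rw [map_zero, Finsupp.zero_apply]
    refine IsHausdorff.haus (I := I) inferInstance _ fun n => ?_
    rw [SModEq.zero, smul_eq_mul, Ideal.mul_top]
    exact (mem_smul_top_iff_repr b _).1 (SModEq.zero.1 (hx n)) i
  prec' f hf := by
    have := Fintype.ofFinite ι
    have h (i : ι) : ∃ L : B, ∀ n, b.repr (f n) i ≡ L [SMOD (I ^ n • ⊤ : Submodule B B)] := by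
      refine IsPrecomplete.prec (I := I) inferInstance fun {m n} hmn => ?_
      have := hf hmn
      rw [SModEq.sub_mem] at this ⊢
      rw [smul_eq_mul, Ideal.mul_top]
      simpa using (mem_smul_top_iff_repr b _).1 this i
    choose L hL using h
    refine ⟨∑ i, L i • b i, fun n => ?_⟩
    rw [SModEq.sub_mem, mem_smul_top_iff_repr b]
    intro i
    have := hL i n
    rw [SModEq.sub_mem, smul_eq_mul, Ideal.mul_top] at this
    rwa [map_sub, Finsupp.sub_apply, b.repr_sum_self]

open MvPowerSeries in
/-- The part of total degree at least `n` of a power series in finitely many variables lies in the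
`n`-th power of the ideal generated by the variables. -/
theorem sub_truncTotal_mem {σ k : Type*} [Finite σ] [CommRing k] (n : ℕ)
    (p : MvPowerSeries σ k) :
    p - (truncTotal n p : MvPolynomial σ k) ∈
      (Ideal.span (Set.range X) : Ideal (MvPowerSeries σ k)) ^ n := by
  set J := MvPolynomial.idealOfVars σ k
  have h1 : toAdicCompletion σ k (p - (truncTotal n p : MvPolynomial σ k)) ∈
      (J ^ n • ⊤ : Submodule (MvPolynomial σ k) (AdicCompletion J (MvPolynomial σ k))) := by
    rw [AdicCompletion.pow_smul_top_eq_ker_eval (MvPolynomial.idealOfVars_fg σ k),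
      LinearMap.mem_ker, AdicCompletion.eval_apply, toAdicCompletion_apply_eq_mk_truncTotal,
      map_sub]
    have : truncTotal n ((truncTotal n p : MvPolynomial σ k) : MvPowerSeries σ k) =
        truncTotal n p := by
      ext x
      simp only [coeff_truncTotal_eq_ite, MvPolynomial.coeff_coe]
      split_ifs <;> rfl
    rw [this, sub_self]
    rfl
  have h2 : p - (truncTotal n p : MvPolynomial σ k) ∈
      (J ^ n • ⊤ : Submodule (MvPolynomial σ k) (MvPowerSeries σ k)) := by
    have := Submodule.mem_map_of_mem (f := (toAdicCompletionAlgEquiv σ k).symm.toLinearMap) h1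
    rw [Submodule.map_smul''] at this
    have h3 := Submodule.smul_mono le_rfl
      (le_top : Submodule.map (toAdicCompletionAlgEquiv σ k).symm.toLinearMap ⊤ ≤ ⊤) this
    rwa [← toAdicCompletionAlgEquiv_apply, AlgEquiv.toLinearMap_apply,
      AlgEquiv.symm_apply_apply] at h3
  have h3 : (J ^ n).map (algebraMap (MvPolynomial σ k) (MvPowerSeries σ k)) =
      (Ideal.span (Set.range X) : Ideal (MvPowerSeries σ k)) ^ n := by
    rw [Ideal.map_pow]
    congr 1
    simp only [J, MvPolynomial.idealOfVars, Ideal.map_span, ← Set.range_comp]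
    congr 2
    ext1 i
    simp [MvPowerSeries.algebraMap_apply']
  rw [← h3]
  rw [Ideal.smul_top_eq_map] at h2
  exact h2

theorem span_range_pow_le {σ E : Type*} [Finite σ] [CommRing E] {I : Ideal E}
    {u : σ → E} (hu : ∀ i, u i ∈ I.radical) :
    ∃ N, ∀ n, (Ideal.span (Set.range u)) ^ (N * n) ≤ I ^ n := by
  obtain ⟨N, hN⟩ := Ideal.exists_pow_le_of_le_radical_of_fg (I := Ideal.span (Set.range u))
    (J := I) (Ideal.span_le.2 (by rintro _ ⟨i, rfl⟩; exact hu i))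
    (Submodule.fg_span (Set.finite_range u))
  exact ⟨N, fun n => by rw [pow_mul]; exact Ideal.pow_right_mono hN n⟩

/-- Power series can be evaluated at topologically nilpotent elements of an adically complete
algebra. -/
theorem exists_algHom_X_eq {σ k E : Type*} [Finite σ] [CommRing k] [CommRing E] [Algebra k E]
    (I : Ideal E) [IsAdicComplete I E] (u : σ → E) (hu : ∀ i, u i ∈ I.radical) :
    ∃ θ : MvPowerSeries σ k →ₐ[k] E, ∀ i, θ (MvPowerSeries.X i) = u i := by
  obtain ⟨N, hN⟩ := span_range_pow_le hu
  have hN' (n : ℕ) {p : MvPolynomial σ k} (hp : p ∈ MvPolynomial.idealOfVars σ k ^ (N * n)) :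
      MvPolynomial.aeval u p ∈ I ^ n := by
    refine hN n ?_
    have := Ideal.mem_map_of_mem (MvPolynomial.aeval u : MvPolynomial σ k →ₐ[k] E) hp
    rw [Ideal.map_pow, MvPolynomial.idealOfVars, Ideal.map_span, ← Set.range_comp] at this
    convert this using 4
    ext i
    simp
  let g (n : ℕ) : (MvPolynomial σ k ⧸ MvPolynomial.idealOfVars σ k ^ (N * n)) →ₐ[k] E ⧸ I ^ n :=
    Ideal.Quotient.liftₐ _ ((Ideal.Quotient.mkₐ k (I ^ n)).comp (MvPolynomial.aeval u))
      fun p hp => Ideal.Quotient.eq_zero_iff_mem.2 (hN' n hp)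
  let f (n : ℕ) : MvPowerSeries σ k →ₐ[k] E ⧸ I ^ n :=
    (g n).comp ((MvPowerSeries.truncTotalAlgHom σ k (N * n)).restrictScalars k)
  have hf (n : ℕ) (p : MvPowerSeries σ k) : f n p =
      Ideal.Quotient.mk (I ^ n) (MvPolynomial.aeval u (p.truncTotal (N * n))) := rfl
  have hcomp {m n : ℕ} (hle : m ≤ n) :
      (Ideal.Quotient.factorₐ k (Ideal.pow_le_pow_right hle)).comp (f n) = f m := by
    ext p
    rw [AlgHom.comp_apply, hf, hf]
    change Ideal.Quotient.mk (I ^ m) _ = _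
    rw [Ideal.Quotient.mk_eq_mk_iff_sub_mem, ← map_sub]
    exact hN' m (MvPowerSeries.truncTotal_sub_truncTotal_mem_pow_idealOfVars
      (Nat.mul_le_mul_left N hle) le_rfl p)
  refine ⟨IsAdicComplete.liftAlgHom I f hcomp, fun i => ?_⟩
  rw [IsHausdorff.eq_iff_smodEq (I := I)]
  intro n
  rw [SModEq.sub_mem, smul_eq_mul, Ideal.mul_top, ← Ideal.Quotient.mk_eq_mk_iff_sub_mem,
    IsAdicComplete.mk_liftAlgHom, hf, Ideal.Quotient.mk_eq_mk_iff_sub_mem]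
  have : MvPolynomial.aeval u (MvPolynomial.X i : MvPolynomial σ k) = u i := by simp
  rw [← this, ← map_sub]
  refine hN' n ((MvPolynomial.mem_pow_idealOfVars_iff' _ _).2 fun x hx => ?_)
  rw [MvPolynomial.coeff_sub, MvPowerSeries.coeff_truncTotal _ hx, ← MvPolynomial.coe_X,
    MvPolynomial.coeff_coe, sub_self]

/-- An evaluation of power series is determined by the values of the variables. -/
theorem algHom_eq_of_X_eq {σ k E : Type*} [Finite σ] [CommRing k] [CommRing E] [Algebra k E]
    (I : Ideal E) [IsHausdorff I E] {θ θ' : MvPowerSeries σ k →ₐ[k] E}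
    (h : ∀ i, θ (MvPowerSeries.X i) = θ' (MvPowerSeries.X i))
    (hI : ∀ i, θ (MvPowerSeries.X i) ∈ I.radical) : θ = θ' := by
  obtain ⟨N, hN⟩ := span_range_pow_le hI
  have hpol (p : MvPolynomial σ k) : θ (p : MvPowerSeries σ k) = θ' (p : MvPowerSeries σ k) := by
    have : (θ.comp (MvPolynomial.coeToMvPowerSeries.algHom k)) =
        (θ'.comp (MvPolynomial.coeToMvPowerSeries.algHom k)) := by
      ext i
      simpa using h i
    simpa using DFunLike.congr_fun this p
  have key (φ : MvPowerSeries σ k →ₐ[k] E)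
      (hφ : ∀ i, φ (MvPowerSeries.X i) = θ (MvPowerSeries.X i)) (n : ℕ) (p : MvPowerSeries σ k)
      (hp : p ∈ (Ideal.span (Set.range MvPowerSeries.X) : Ideal (MvPowerSeries σ k)) ^ (N * n)) :
      φ p ∈ I ^ n := by
    refine hN n ?_
    have := Ideal.mem_map_of_mem φ hp
    rw [Ideal.map_pow, Ideal.map_span, ← Set.range_comp] at this
    convert this using 4
    ext i
    exact (hφ i).symm
  ext p
  rw [IsHausdorff.eq_iff_smodEq (I := I)]
  intro n
  rw [SModEq.sub_mem, smul_eq_mul, Ideal.mul_top]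
  have hp := sub_truncTotal_mem (N * n) p
  have h1 := key θ (fun _ => rfl) n _ hp
  have h2 := key θ' (fun i => (h i).symm) n _ hp
  have := (I ^ n).sub_mem h1 h2
  rw [map_sub, map_sub, hpol] at this
  convert this using 1
  ring

/-- Solvability of `p = ∑ b i * a i + ∑ q j * g j`, with `b i` in the smaller ring `B` and `q j` in
`R`, may be tested modulo an ideal of `B`, by successive approximation. -/
theorem exists_eq_sum_add_sum {B R ι κ : Type*} [CommRing B] [CommRing R] [Algebra B R]
    [Fintype ι] [Fintype κ] (Y : Ideal B) [IsPrecomplete Y B] (P : Ideal R) [IsAdicComplete P R]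
    (hYP : Y.map (algebraMap B R) ≤ P) (a : ι → R) (g : κ → R)
    (H : ∀ p : R, ∃ (b : ι → B) (q : κ → R),
      p - (∑ i, algebraMap B R (b i) * a i + ∑ j, q j * g j) ∈ Y.map (algebraMap B R)) (p : R) :
    ∃ (b : ι → B) (q : κ → R), p = ∑ i, algebraMap B R (b i) * a i + ∑ j, q j * g j := by
  set Z := Y.map (algebraMap B R) with hZ
  let S (b : ι → B) (q : κ → R) : R := ∑ i, algebraMap B R (b i) * a i + ∑ j, q j * g j
  have S_add (b b' : ι → B) (q q' : κ → R) : S (b + b') (q + q') = S b q + S b' q' := by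
    simp only [S, Pi.add_apply, map_add, add_mul, Finset.sum_add_distrib]
    ring
  have map_mem {n : ℕ} {y : B} (hy : y ∈ Y ^ n) : algebraMap B R y ∈ Z ^ n := by
    rw [hZ, ← Ideal.map_pow]
    exact Ideal.mem_map_of_mem _ hy
  have step (n : ℕ) (p : R) (hp : p ∈ Z ^ n) : ∃ (b : ι → B) (q : κ → R),
      (∀ i, b i ∈ Y ^ n) ∧ (∀ j, q j ∈ Z ^ n) ∧ p - S b q ∈ Z ^ (n + 1) := by
    rw [hZ, ← Ideal.map_pow] at hp
    replace hp : p ∈ (Y ^ n • ⊤ : Submodule B R) := by rwa [Ideal.smul_top_eq_map]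
    induction hp using Submodule.smul_induction_on' with
    | smul y hy r _ =>
      obtain ⟨b, q, hbq⟩ := H r
      refine ⟨fun i => y * b i, fun j => algebraMap B R y * q j,
        fun i => Ideal.mul_mem_right _ _ hy, fun j => Ideal.mul_mem_right _ _ (map_mem hy), ?_⟩
      have : y • r - S (fun i => y * b i) (fun j => algebraMap B R y * q j) =
          algebraMap B R y * (r - S b q) := by
        simp only [S, map_mul, mul_assoc, ← Finset.mul_sum, Algebra.smul_def]
        ring
      rw [this, pow_succ]
      exact Ideal.mul_mem_mul (map_mem hy) hbq
    | add x _ y _ hx hy =>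
      obtain ⟨b, q, hb, hq, h⟩ := hx
      obtain ⟨b', q', hb', hq', h'⟩ := hy
      refine ⟨b + b', q + q', fun i => Ideal.add_mem _ (hb i) (hb' i),
        fun j => Ideal.add_mem _ (hq j) (hq' j), ?_⟩
      rw [S_add, add_sub_add_comm]
      exact Ideal.add_mem _ h h'
  choose! fb fq hfb hfq hfS using step
  let rem (n : ℕ) : R := n.rec p fun n x => x - S (fb n x) (fq n x)
  have rem_succ (n : ℕ) : rem (n + 1) = rem n - S (fb n (rem n)) (fq n (rem n)) := rfl
  have rem_mem (n : ℕ) : rem n ∈ Z ^ n := by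
    induction n with
    | zero => simp
    | succ n ih => rw [rem_succ]; exact hfS n _ ih
  let sb (n : ℕ) : ι → B := ∑ s ∈ Finset.range n, fb s (rem s)
  let sq (n : ℕ) : κ → R := ∑ s ∈ Finset.range n, fq s (rem s)
  have hsum (n : ℕ) : p = rem n + S (sb n) (sq n) := by
    induction n with
    | zero => simp [rem, sb, sq, S]
    | succ n ih =>
      simp only [sb, sq, Finset.sum_range_succ] at ih ⊢
      rw [S_add, rem_succ]
      linear_combination ih
  have hsb (i : ι) : ∃ L : B, ∀ n, sb n i ≡ L [SMOD (Y ^ n • ⊤ : Submodule B B)] := by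
    refine IsPrecomplete.prec (I := Y) inferInstance fun {m n} hmn => SModEq.symm ?_
    rw [SModEq.sub_mem, smul_eq_mul, Ideal.mul_top]
    simp only [sb, Finset.sum_apply, ← Finset.sum_Ico_eq_sub _ hmn]
    exact Ideal.sum_mem _ fun s hs => Ideal.pow_le_pow_right (Finset.mem_Ico.1 hs).1
      (hfb s _ (rem_mem s) i)
  have hsq (j : κ) : ∃ L : R, ∀ n, sq n j ≡ L [SMOD (P ^ n • ⊤ : Submodule R R)] := by
    refine IsPrecomplete.prec (I := P) inferInstance fun {m n} hmn => SModEq.symm ?_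
    rw [SModEq.sub_mem, smul_eq_mul, Ideal.mul_top]
    simp only [sq, Finset.sum_apply, ← Finset.sum_Ico_eq_sub _ hmn]
    exact Ideal.sum_mem _ fun s hs => Ideal.pow_le_pow_right (Finset.mem_Ico.1 hs).1
      (Ideal.pow_right_mono hYP s (hfq s _ (rem_mem s) j))
  choose b hb using hsb
  choose q hq using hsq
  refine ⟨b, q, ?_⟩
  rw [IsHausdorff.eq_iff_smodEq (I := P)]
  intro n
  rw [SModEq.sub_mem, smul_eq_mul, Ideal.mul_top]
  have h1 : p - S b q = rem n + (∑ i, algebraMap B R (sb n i - b i) * a i +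
      ∑ j, (sq n j - q j) * g j) := by
    conv_lhs => rw [hsum n]
    simp only [S, map_sub, sub_mul, Finset.sum_sub_distrib]
    ring
  change p - S b q ∈ P ^ n
  rw [h1]
  refine Ideal.add_mem _ (Ideal.pow_right_mono hYP n (rem_mem n)) (Ideal.add_mem _
    (Ideal.sum_mem _ fun i _ => Ideal.mul_mem_right _ _ (Ideal.pow_right_mono hYP n (map_mem ?_)))
    (Ideal.sum_mem _ fun j _ => Ideal.mul_mem_right _ _ ?_))
  · simpa [SModEq.sub_mem] using hb i n
  · simpa [SModEq.sub_mem] using hq j n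

end Adic

/-! ### Left inverses from Weierstrass division -/

section Division

/-- The quotient of Weierstrass division by a series that is regular of order `N` in the last
variable, as a linear map over the ring of power series in the other variables. -/
theorem exists_leftInverse_mul_powerSeries {σ k : Type*} [Finite σ] [CommRing k]
    (Δ : PowerSeries (MvPowerSeries σ k)) (N : ℕ)
    (h0 : ∀ j < N, MvPowerSeries.constantCoeff (Δ.coeff j) = 0)
    (h1 : IsUnit (MvPowerSeries.constantCoeff (Δ.coeff N))) :
    ∃ S : PowerSeries (MvPowerSeries σ k) →ₗ[MvPowerSeries σ k] PowerSeries (MvPowerSeries σ k),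
      ∀ p, S (Δ * p) = p := by
  rcases subsingleton_or_nontrivial k with hk | hk
  · refine ⟨0, fun p => ?_⟩
    ext j x
    exact Subsingleton.elim _ _
  set I : Ideal (MvPowerSeries σ k) := Ideal.span (Set.range MvPowerSeries.X) with hI
  have hmem {p : MvPowerSeries σ k} : p ∈ I ↔ MvPowerSeries.constantCoeff p = 0 := by
    constructor
    · intro hp
      have : I ≤ RingHom.ker (MvPowerSeries.constantCoeff (σ := σ) (R := k)) := by
        rw [hI, Ideal.span_le]
        rintro _ ⟨i, rfl⟩
        simp
      exact this hp
    · intro hp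
      have := sub_truncTotal_mem 1 p
      rw [pow_one] at this
      have h2 : p.truncTotal 1 = 0 := by
        ext x
        rw [MvPowerSeries.coeff_truncTotal_eq_ite]
        split_ifs with hx
        · have : x = 0 := (Finsupp.degree_eq_zero_iff x).1 (Nat.lt_one_iff.1 hx)
          simpa [this] using hp
        · simp
      rwa [h2, MvPolynomial.coe_zero, sub_zero] at this
  have hord : (Δ.map (Ideal.Quotient.mk I)).order = N := by
    rw [PowerSeries.order_eq_nat]
    refine ⟨?_, fun j hj => ?_⟩
    · rw [PowerSeries.coeff_map, Ne, Ideal.Quotient.eq_zero_iff_mem, hmem]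
      exact h1.ne_zero
    · rw [PowerSeries.coeff_map, Ideal.Quotient.eq_zero_iff_mem, hmem]
      exact h0 j hj
  have H : Δ.IsWeierstrassDivisorAt I := by
    rw [PowerSeries.IsWeierstrassDivisorAt, hord, ENat.toNat_natCast,
      MvPowerSeries.isUnit_iff_constantCoeff]
    exact h1
  refine ⟨⟨⟨fun p => H.div p, fun _ _ => H.div_add _ _⟩, fun _ _ => H.div_smul _ _⟩, fun p => ?_⟩
  obtain ⟨h2, h3⟩ := H.isWeierstrassDivisionAt_div_mod (Δ * p)
  exact (H.eq_of_mul_add_eq_mul_add (r' := 0) h2 (by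
    rw [Polynomial.degree_zero]; exact WithBot.bot_lt_coe _) (by simpa using h3.symm)).1

theorem rename_congr {σ τ k : Type*} [CommRing k] {f g : σ → τ} [Filter.TendstoCofinite f]
    [Filter.TendstoCofinite g] (h : f = g) (p : MvPowerSeries σ k) :
    MvPowerSeries.rename f p = MvPowerSeries.rename g p := by
  subst h
  rfl

theorem optionEquivLeft_rename_some {σ k : Type*} [CommRing k] (p : MvPowerSeries σ k) :
    MvPowerSeries.optionEquivLeft σ k
      (MvPowerSeries.rename (Function.Embedding.some : σ ↪ Option σ) p) = PowerSeries.C p := by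
  ext n x
  rw [MvPowerSeries.coeff_coeff_optionEquivLeft, PowerSeries.coeff_C]
  split_ifs with hn
  · subst hn
    rw [← MvPowerSeries.coeff_embDomain_rename Function.Embedding.some p x]
    congr 1
    congr 1
    ext (_ | i)
    · rw [Finsupp.optionElim_apply_none, Finsupp.embDomain_of_notMem_range]
      simp
    · rw [Finsupp.optionElim_apply_some]
      exact (Finsupp.embDomain_apply_self Function.Embedding.some x i).symm
  · rw [map_zero]
    refine MvPowerSeries.coeff_rename_eq_zero _ _ ?_
    rintro ⟨y, hy⟩
    apply hn
    have := congrArg (fun z => z none) hy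
    rw [Finsupp.optionElim_apply_none] at this
    rw [← this, Finsupp.mapDomain_of_notMem_range]
    simp

/-- Multiplication by a power series that is regular in the variable `X i` has a left inverse which
is linear over the power series in the other variables: the quotient of Weierstrass division. -/
theorem exists_leftInverse_mul {τ υ k : Type*} [Finite τ] [CommRing k] (i : τ) (e : υ ↪ τ)
    (he : i ∉ Set.range e) (Δ : MvPowerSeries τ k) (N : ℕ)
    (h0 : ∀ j < N, Δ.coeff (Finsupp.single i j) = 0)
    (h1 : IsUnit (Δ.coeff (Finsupp.single i N))) :
    ∃ S : MvPowerSeries τ k →+ MvPowerSeries τ k, (∀ p, S (Δ * p) = p) ∧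
      ∀ (v : MvPowerSeries υ k) p,
        S (MvPowerSeries.rename e v * p) = MvPowerSeries.rename e v * S p := by
  classical
  have := Finite.of_injective e e.injective
  let ε : τ ≃ Option {j // j ≠ i} := (Equiv.optionSubtypeNe i).symm
  let Φ : MvPowerSeries τ k ≃ₐ[k] PowerSeries (MvPowerSeries {j // j ≠ i} k) :=
    (MvPowerSeries.renameEquiv k ε).trans (MvPowerSeries.optionEquivLeft _ k)
  have hcoeff (j : ℕ) : MvPowerSeries.constantCoeff ((Φ Δ).coeff j) =
      Δ.coeff (Finsupp.single i j) := by
    rw [← MvPowerSeries.coeff_zero_eq_constantCoeff_apply]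
    simp only [Φ, AlgEquiv.trans_apply]
    rw [MvPowerSeries.coeff_coeff_optionEquivLeft]
    have : (0 : {j // j ≠ i} →₀ ℕ).optionElim j =
        Finsupp.embDomain ε.toEmbedding (Finsupp.single i j) := by
      rw [Finsupp.embDomain_single]
      ext (_ | l)
      · simp [ε]
      · simp [ε]
    rw [this]
    exact MvPowerSeries.coeff_embDomain_rename ε.toEmbedding Δ _
  obtain ⟨S, hS⟩ := exists_leftInverse_mul_powerSeries (Φ Δ) N
    (fun j hj => by rw [hcoeff, h0 j hj]) (by rwa [hcoeff])
  let e' : υ ↪ {j // j ≠ i} := ⟨fun x => ⟨e x, fun h => he ⟨x, h⟩⟩,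
    fun x y h => e.injective (congrArg Subtype.val h)⟩
  have hΦ (v : MvPowerSeries υ k) : Φ (MvPowerSeries.rename e v) =
      PowerSeries.C (MvPowerSeries.rename e' v) := by
    rw [← optionEquivLeft_rename_some]
    simp only [Φ, AlgEquiv.trans_apply]
    congr 1
    change MvPowerSeries.rename ε _ = _
    rw [MvPowerSeries.rename_rename, MvPowerSeries.rename_rename]
    refine rename_congr (funext fun x => ?_) v
    simp only [ε, Function.comp_apply]
    rw [Equiv.symm_apply_eq]
    rfl
  refine ⟨((Φ.symm : _ ≃+ _).toAddMonoidHom.comp S.toAddMonoidHom).comp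
    (Φ : _ ≃+ _).toAddMonoidHom, fun p => ?_, fun v p => ?_⟩
  · change Φ.symm (S (Φ (Δ * p))) = p
    rw [map_mul, hS, AlgEquiv.symm_apply_apply]
  · change Φ.symm (S (Φ (_ * p))) = _ * Φ.symm (S (Φ p))
    rw [map_mul, hΦ, ← PowerSeries.smul_eq_C_mul, map_smul, PowerSeries.smul_eq_C_mul, map_mul,
      ← hΦ, AlgEquiv.symm_apply_apply]

end Division

/-! ### Products of entries of band matrices with vanishing minors -/

section Toeplitz

variable {Z : Type*} [CommRing Z]

theorem perm_eq_one_of_monotone {m : ℕ} {τ : Equiv.Perm (Fin m)} (h : Monotone τ) : τ = 1 := by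
  have h1 := (h.strictMono_of_injective τ.injective)
  have : (h1.orderIsoOfSurjective _ τ.surjective) = OrderIso.refl (Fin m) := Subsingleton.elim _ _
  ext i
  exact congrArg (fun f : Fin m ≃o Fin m => ((f i : Fin m) : ℕ)) this

/-- The diagonal term of a band minor has the smallest sum of squares of indices. -/
theorem sum_sq_lt_of_perm {m : ℕ} {c : Fin m → ℕ} (hc : StrictMono c) {τ : Equiv.Perm (Fin m)}
    (hτ : τ ≠ 1) (h1 : ∀ q : Fin m, (q : ℕ) ≤ c q) (h2 : ∀ q, (τ q : ℕ) ≤ c q) :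
    ∑ q : Fin m, (c q - q) ^ 2 < ∑ q, (c q - τ q) ^ 2 := by
  have key : ∑ q, c q * (τ q : ℕ) < ∑ q : Fin m, c q * (q : ℕ) := by
    have hmono : Monovary c (fun q : Fin m => (q : ℕ)) := fun i j hij => hc.monotone hij.le
    refine (hmono.sum_mul_comp_perm_lt_sum_mul_iff (σ := τ)).2 fun h => hτ ?_
    refine perm_eq_one_of_monotone fun i j hij => ?_
    by_contra hlt
    have := h (i := j) (j := i) (by simpa using hlt)
    have := hc.le_iff_le.1 this
    have : i = j := le_antisymm hij this
    subst this
    exact hlt le_rfl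
  have hsq : ∑ q, (τ q : ℕ) ^ 2 = ∑ q : Fin m, (q : ℕ) ^ 2 :=
    Equiv.sum_comp τ fun q : Fin m => (q : ℕ) ^ 2
  have e1 : ((∑ q : Fin m, (c q - q) ^ 2 : ℕ) : ℤ) =
      ∑ q, (c q : ℤ) ^ 2 - 2 * ∑ q : Fin m, (c q : ℤ) * (q : ℕ) +
        ∑ q : Fin m, ((q : ℕ) : ℤ) ^ 2 := by
    rw [Finset.mul_sum, ← Finset.sum_sub_distrib, ← Finset.sum_add_distrib, Nat.cast_sum]
    refine Finset.sum_congr rfl fun q _ => ?_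
    rw [Nat.cast_pow, Nat.cast_sub (h1 q)]
    ring
  have e2 : ((∑ q : Fin m, (c q - τ q) ^ 2 : ℕ) : ℤ) =
      ∑ q, (c q : ℤ) ^ 2 - 2 * ∑ q : Fin m, (c q : ℤ) * (τ q : ℕ) +
        ∑ q : Fin m, ((τ q : ℕ) : ℤ) ^ 2 := by
    rw [Finset.mul_sum, ← Finset.sum_sub_distrib, ← Finset.sum_add_distrib, Nat.cast_sum]
    refine Finset.sum_congr rfl fun q _ => ?_
    rw [Nat.cast_pow, Nat.cast_sub (h2 q)]
    ring
  zify at key hsq ⊢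
  push_cast at e1 e2
  rw [e1, e2, hsq]
  linarith

theorem sum_sq_le_sq_sum {m : ℕ} (e : Fin m → ℕ) : ∑ q, e q ^ 2 ≤ (∑ q, e q) ^ 2 := by
  rw [sq (∑ q, e q), Finset.sum_mul]
  refine Finset.sum_le_sum fun q _ => ?_
  rw [sq]
  exact Nat.mul_le_mul_left _ (Finset.single_le_sum (fun _ _ => Nat.zero_le _) (Finset.mem_univ q))

/-- If the maximal minors of the band matrix with `m` shifted rows `u 0, u 1, …` vanish, then a
product of `m` entries is an integral combination of products of the same weight with an
entry of index at least `r`. -/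
theorem prod_mem_closure_of_minors_eq_zero {u : ℕ → Z} {r m : ℕ}
    (hdet : ∀ c : Fin m → ℕ, StrictMono c → (∀ q, c q < m - 1 + r) →
      (Matrix.of fun p q : Fin m => if (p : ℕ) ≤ c q then u (c q - p) else 0).det = 0)
    (e : Fin m → ℕ) : ∏ q, u (e q) ∈ AddSubgroup.closure
      {z | ∃ e' : Fin m → ℕ, ∑ q, e' q = ∑ q, e q ∧ (∃ q, r ≤ e' q) ∧ ∏ q, u (e' q) = z} := by
  -- the sum of the indices is constant and bounds the sum of squares, which grows at each step
  obtain ⟨k, hk⟩ : ∃ k, k = (∑ q, e q) ^ 2 - ∑ q, e q ^ 2 := ⟨_, rfl⟩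
  induction k using Nat.strong_induction_on generalizing e with
  | _ k ih =>
  by_cases hr : ∃ q, r ≤ e q
  · exact AddSubgroup.subset_closure ⟨e, rfl, hr, rfl⟩
  push Not at hr
  wlog he : Monotone e generalizing e
  · have h1 := Equiv.sum_comp (Tuple.sort e) e
    have h2 := Equiv.sum_comp (Tuple.sort e) (fun q => e q ^ 2)
    have h3 := Equiv.prod_comp (Tuple.sort e) (fun q => u (e q))
    have := this (e ∘ Tuple.sort e) (by simp only [Function.comp_apply]; rw [h1, h2, hk])
      (fun q => hr _) (Tuple.monotone_sort e)
    simp only [Function.comp_apply] at this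
    rwa [h1, h3] at this
  -- the columns `c q` put the product at hand on the diagonal of a minor
  set c : Fin m → ℕ := fun q => q + e q with hc
  have hcm : StrictMono c := fun i j hij => add_lt_add_of_lt_of_le hij (he hij.le)
  have hdet' := hdet c hcm fun q => by have := hr q; have := q.2; simp only [hc]; omega
  rw [Matrix.det_apply, ← Finset.add_sum_erase _ _ (Finset.mem_univ 1)] at hdet'
  have h1 : (∏ i : Fin m, (Matrix.of fun p q : Fin m => if (p : ℕ) ≤ c q then u (c q - p) else 0)
      ((1 : Equiv.Perm (Fin m)) i) i) = ∏ q, u (e q) :=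
    Finset.prod_congr rfl fun q _ => by simp [hc]
  rw [Equiv.Perm.sign_one, one_smul, h1] at hdet'
  rw [eq_neg_of_add_eq_zero_left hdet']
  refine AddSubgroup.neg_mem _ (AddSubgroup.sum_mem _ fun τ hτ => ?_)
  have hτ1 : τ ≠ 1 := Finset.ne_of_mem_erase hτ
  have hsgn (z : Z) {A : AddSubgroup Z} (hz : z ∈ A) : Equiv.Perm.sign τ • z ∈ A := by
    rcases Int.units_eq_one_or (Equiv.Perm.sign τ) with h | h <;> rw [h]
    · rwa [one_smul]
    · rw [Units.neg_smul, one_smul]; exact A.neg_mem hz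
  refine hsgn _ ?_
  by_cases hle : ∀ q, (τ q : ℕ) ≤ c q
  · have h2 : (∏ i : Fin m, (Matrix.of fun p q : Fin m =>
        if (p : ℕ) ≤ c q then u (c q - p) else 0) (τ i) i) = ∏ q, u (c q - τ q) :=
      Finset.prod_congr rfl fun q _ => by simp [hle q]
    have hsum : ∑ q, (c q - τ q) = ∑ q, e q := by
      have h3 : ∑ q, (c q - τ q) + ∑ q, (τ q : ℕ) = ∑ q, e q + ∑ q : Fin m, (q : ℕ) := by
        rw [← Finset.sum_add_distrib, ← Finset.sum_add_distrib]
        refine Finset.sum_congr rfl fun q _ => ?_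
        rw [Nat.sub_add_cancel (hle q), add_comm]
      have h4 := Equiv.sum_comp τ fun q : Fin m => (q : ℕ)
      omega
    have hlt := sum_sq_lt_of_perm hcm hτ1 (fun q => by simp [hc]) hle
    have hle' := sum_sq_le_sq_sum fun q => c q - τ q
    simp only [hc, Nat.add_sub_cancel_left] at hlt
    simp only [hc] at hle' hsum
    rw [h2]
    simp only [hc]
    have := ih ((∑ q, e q) ^ 2 - ∑ q, (q + e q - τ q) ^ 2) (by rw [hsum] at hle'; omega)
      (fun q => q + e q - τ q) (by rw [hsum])
    rwa [hsum] at this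
  · push Not at hle
    obtain ⟨q, hq⟩ := hle
    rw [Finset.prod_eq_zero (Finset.mem_univ q)]
    · exact zero_mem _
    · simp [hq]

theorem exists_univ_map_eq {α : Type*} {t : Multiset α} {m : ℕ} (h : t.card = m) :
    ∃ e : Fin m → α, t = Finset.univ.val.map e := by
  have hl : t.toList.length = m := by rw [Multiset.length_toList, h]
  subst hl
  refine ⟨t.toList.get, ?_⟩
  rw [Fin.univ_val_map, List.ofFn_get, Multiset.coe_toList]

/-- Iterating `prod_mem_closure_of_minors_eq_zero`, any product of the `u j` is an integral
combination of products of the same length and weight with fewer than `m` factors of index less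
than `r`. -/
theorem multiset_prod_mem_closure {u : ℕ → Z} {r m : ℕ}
    (hdet : ∀ c : Fin m → ℕ, StrictMono c → (∀ q, c q < m - 1 + r) →
      (Matrix.of fun p q : Fin m => if (p : ℕ) ≤ c q then u (c q - p) else 0).det = 0)
    (s : Multiset ℕ) : (s.map u).prod ∈ AddSubgroup.closure
      {z | ∃ t : Multiset ℕ, t.card = s.card ∧ t.sum = s.sum ∧
        (t.filter (· < r)).card < m ∧ (t.map u).prod = z} := by
  obtain ⟨k, hk⟩ : ∃ k, k = (s.filter (· < r)).card := ⟨_, rfl⟩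
  induction k using Nat.strong_induction_on generalizing s with
  | _ k ih =>
  rcases lt_or_ge k m with hkm | hkm
  · exact AddSubgroup.subset_closure ⟨s, rfl, rfl, hk ▸ hkm, rfl⟩
  obtain ⟨t, hts, htm⟩ : ∃ t, t ≤ s.filter (· < r) ∧ t.card = m := by
    have : (Multiset.powersetCard m (s.filter (· < r))) ≠ 0 := by
      rw [← Multiset.card_pos, Multiset.card_powersetCard, ← hk]
      exact Nat.choose_pos hkm
    obtain ⟨t, ht⟩ := Multiset.exists_mem_of_ne_zero this
    exact ⟨t, (Multiset.mem_powersetCard.1 ht).1, (Multiset.mem_powersetCard.1 ht).2⟩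
  obtain ⟨w, rfl⟩ := Multiset.le_iff_exists_add.1 (hts.trans (Multiset.filter_le _ _))
  have htr : ∀ x ∈ t, x < r := fun x hx => (Multiset.mem_filter.1 (Multiset.mem_of_le hts hx)).2
  obtain ⟨e, rfl⟩ : ∃ e : Fin m → ℕ, t = Finset.univ.val.map e := by
    exact exists_univ_map_eq htm
  have h1 := prod_mem_closure_of_minors_eq_zero hdet e
  rw [Multiset.map_add, Multiset.prod_add, Multiset.map_map]
  change (∏ q, u (e q)) * _ ∈ _
  generalize (∏ q, u (e q)) = y at h1 ⊢
  induction h1 using AddSubgroup.closure_induction with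
  | mem x hx =>
    obtain ⟨e', hsum, ⟨q, hq⟩, rfl⟩ := hx
    have := ih (((Finset.univ.val.map e' + w).filter (· < r)).card) ?_
      (Finset.univ.val.map e' + w) rfl
    · simp only [Multiset.map_add, Multiset.prod_add, Multiset.map_map, Multiset.card_add,
        Multiset.card_map, Multiset.sum_add] at this ⊢
      change (∏ q, u (e' q)) * _ ∈ _ at this
      have hs : (Multiset.map e' Finset.univ.val).sum = (Multiset.map e Finset.univ.val).sum := hsum
      rwa [hs] at this
    · rw [hk, Multiset.filter_add, Multiset.filter_add, Multiset.card_add, Multiset.card_add,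
        Multiset.filter_eq_self.2 htr]
      refine Nat.add_lt_add_right (lt_of_lt_of_le
        (Multiset.card_lt_card (t := Finset.univ.val.map e') ?_) ?_) _
      · refine lt_of_le_of_ne (Multiset.filter_le _ _) fun h => ?_
        have := Multiset.filter_eq_self.1 h (e' q)
          (Multiset.mem_map_of_mem _ (Finset.mem_univ_val q))
        omega
      · simp
  | zero => rw [zero_mul]; exact zero_mem _
  | add x y _ _ hx hy => rw [add_mul]; exact add_mem hx hy
  | neg x _ hx => rw [neg_mul]; exact neg_mem hx

section Truncated

variable {u : ℕ → Z} {r m d : ℕ} (hu0 : ∀ j, r ≤ j → j ≠ d → u j = 0) (hud : u d = 1) (hrd : r ≤ d)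
  (hm : 0 < m)
  (hdet : ∀ c : Fin m → ℕ, StrictMono c → (∀ q, c q < m - 1 + r) →
      (Matrix.of fun p q : Fin m => if (p : ℕ) ≤ c q then u (c q - p) else 0).det = 0)
include hu0 hud hdet

/-- If the `u j` are the coefficients of a monic polynomial `X ^ d + u (r - 1) * X ^ (r - 1) +
...`, then the factors with index at least `r` disappear, and products of fewer than `m` of the
remaining coefficients suffice. -/
theorem multiset_prod_mem_closure_card_lt (s : Multiset ℕ) : (s.map u).prod ∈ AddSubgroup.closure
      {z | ∃ t : Multiset ℕ, (∀ x ∈ t, x < r) ∧ t.card < m ∧ (t.map u).prod = z} := by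
  refine AddSubgroup.closure_le _ |>.2 ?_ (multiset_prod_mem_closure hdet s)
  rintro _ ⟨t, -, -, ht, rfl⟩
  rw [← Multiset.filter_add_not (· < r) t, Multiset.map_add, Multiset.prod_add]
  by_cases h : ∀ x ∈ t.filter (¬ · < r), x = d
  · have : ((t.filter (¬ · < r)).map u).prod = 1 := by
      refine Multiset.prod_eq_one fun x hx => ?_
      obtain ⟨y, hy, rfl⟩ := Multiset.mem_map.1 hx
      rw [h y hy, hud]
    rw [this, mul_one]
    exact AddSubgroup.subset_closure ⟨_, fun x hx => (Multiset.mem_filter.1 hx).2, ht, rfl⟩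
  · obtain ⟨x, hx, hxd⟩ := not_forall₂.1 h
    have : ((t.filter (¬ · < r)).map u).prod = 0 := by
      refine Multiset.prod_eq_zero (Multiset.mem_map.2 ⟨x, hx, hu0 x ?_ hxd⟩)
      simpa using (Multiset.mem_filter.1 hx).2
    rw [this, mul_zero]
    exact zero_mem _

include hrd hm in
/-- Long products of coefficients vanish: their weight is too small for enough factors `u d = 1`
to be split off. -/
theorem multiset_prod_eq_zero (s : Multiset ℕ) (hs : ∀ x ∈ s, x < r)
    (hcard : (m - 1) * d < s.card) : (s.map u).prod = 0 := by
  have h0 := multiset_prod_mem_closure hdet s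
  suffices h : AddSubgroup.closure {z | ∃ t : Multiset ℕ, t.card = s.card ∧ t.sum = s.sum ∧
      (t.filter (· < r)).card < m ∧ (t.map u).prod = z} ≤ ⊥ from (AddSubgroup.mem_bot.1 (h h0))
  rw [AddSubgroup.closure_le]
  rintro _ ⟨t, ht1, ht2, ht3, rfl⟩
  by_cases h : ∀ x ∈ t.filter (¬ · < r), x = d
  · exfalso
    have h1 : s.sum ≤ s.card * (r - 1) := by
      have := Multiset.sum_le_card_nsmul s (r - 1) fun x hx => by have := hs x hx; omega
      simpa using this
    have h2 : (t.filter (¬ · < r)).card * d ≤ t.sum := by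
      conv_rhs => rw [← Multiset.filter_add_not (· < r) t, Multiset.sum_add]
      rw [Multiset.eq_replicate_card.2 h]
      simp
    have h3 : (t.filter (· < r)).card + (t.filter (¬ · < r)).card = t.card := by
      rw [← Multiset.card_add, Multiset.filter_add_not]
    have hr : 0 < r := by
      obtain ⟨x, hx⟩ := Multiset.card_pos_iff_exists_mem.1 (lt_of_le_of_lt (Nat.zero_le _) hcard)
      exact lt_of_le_of_lt (Nat.zero_le _) (hs x hx)
    obtain ⟨d, rfl⟩ := Nat.exists_eq_add_of_lt (lt_of_lt_of_le hr hrd)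
    have h4 : s.card * (r - 1) ≤ s.card * d := Nat.mul_le_mul_left _ (by omega)
    obtain ⟨m, rfl⟩ := Nat.exists_eq_add_of_lt hm
    have h5 : (t.filter (· < r)).card * (d + 1) ≤ m * (d + 1) :=
      Nat.mul_le_mul_right _ (by omega)
    rw [← ht1] at h1 h4 hcard
    simp only [zero_add, Nat.add_sub_cancel] at *
    nlinarith
  · obtain ⟨x, hx, hxd⟩ := not_forall₂.1 h
    have hx' := Multiset.mem_filter.1 hx
    exact Multiset.prod_eq_zero (Multiset.mem_map.2 ⟨x, hx'.1, hu0 x (by simpa using hx'.2) hxd⟩)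

end Truncated

end Toeplitz

/-! ### Minors of matrices of relations -/

section Relations

/-- Products of matrices that factor through a space of too small dimension are singular. -/
theorem det_mul_eq_zero_of_card_lt {S ι κ : Type*} [CommRing S] [Fintype ι] [DecidableEq ι]
    [Fintype κ] [DecidableEq κ] (h : Fintype.card ι = Fintype.card κ + 1) (M : Matrix ι κ S)
    (P : Matrix κ ι S) : (M * P).det = 0 := by
  have e : ι ≃ κ ⊕ Unit := Fintype.equivOfCardEq (by simp [h])
  have h1 : M * P = (Matrix.fromCols M (0 : Matrix ι Unit S)).submatrix id e *
      (Matrix.fromRows P (0 : Matrix Unit ι S)).submatrix e id := by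
    rw [Matrix.submatrix_mul_equiv, Matrix.fromCols_mul_fromRows, Matrix.mul_zero, add_zero,
      Matrix.submatrix_id_id]
  rw [h1, Matrix.det_mul, Matrix.det_eq_zero_of_column_eq_zero (e.symm (Sum.inr ())), zero_mul]
  intro i
  simp

/-- If `n` elements generate a module with a free quotient of rank `r`, then the minors of size
greater than `n - r` of the matrices of relations between these elements vanish. Here `W` holds the
relations, `e` the images of the generators in the free quotient, and `V` lifts of its basis. -/
theorem det_eq_zero_of_relations {S : Type*} [CommRing S] {n s r : ℕ} (h : s + r = n + 1)
    (W : Matrix (Fin s) (Fin n) S) (e : Matrix (Fin n) (Fin r) S) (V : Matrix (Fin r) (Fin n) S)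
    (hW : W * e = 0) (hV : V * e = 1) (c : Fin s → Fin n) : (W.submatrix id c).det = 0 := by
  -- the block matrix formed with the minor and an identity block factors through dimension `n`
  have h1 : Matrix.fromRows W V * Matrix.fromCols ((1 : Matrix (Fin n) (Fin n) S).submatrix id c) e
      = Matrix.fromBlocks (W.submatrix id c) 0 (V.submatrix id c) 1 := by
    have hc {q : ℕ} (A : Matrix (Fin q) (Fin n) S) :
        A * (1 : Matrix (Fin n) (Fin n) S).submatrix id c = A.submatrix id c := by
      have := Matrix.submatrix_mul A 1 id id c Function.bijective_id
      rw [Matrix.mul_one, Matrix.submatrix_id_id] at this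
      exact this.symm
    rw [Matrix.fromRows_mul_fromCols, hW, hV, hc, hc]
  have h2 := det_mul_eq_zero_of_card_lt (by simp [h]) (Matrix.fromRows W V)
    (Matrix.fromCols ((1 : Matrix (Fin n) (Fin n) S).submatrix id c) e)
  rwa [h1, Matrix.det_fromBlocks_zero₁₂, Matrix.det_one, mul_one] at h2

end Relations

/-! ### Monic polynomials with given coefficients -/

section MonicPoly

variable {A : Type*} [CommRing A]

theorem monicPoly_coeff_of_lt {d : ℕ} (c : Fin d → A) {j : ℕ} (hj : j < d) :
    (monicPoly d c).coeff j = c ⟨d - 1 - j, by omega⟩ := by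
  rw [monicPoly, coeff_add, coeff_X_pow, if_neg hj.ne, zero_add, finsetSum_coeff,
    Finset.sum_eq_single ⟨d - 1 - j, by omega⟩]
  · rw [coeff_C_mul_X_pow, if_pos (by simp only []; omega)]
  · intro i _ hi
    rw [coeff_C_mul_X_pow, if_neg]
    rintro rfl
    apply hi
    ext
    have := i.2
    simp only []
    omega
  · simp

theorem monicPoly_natDegree [Nontrivial A] {d : ℕ} (c : Fin d → A) :
    (monicPoly d c).natDegree = d := by
  have h : (∑ i : Fin d, C (c i) * X ^ (d - 1 - (i : ℕ))).degree < (d : WithBot ℕ) := by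
    refine (degree_sum_le _ _).trans_lt ?_
    rw [Finset.sup_lt_iff (by exact_mod_cast WithBot.bot_lt_coe d)]
    intro i _
    refine (degree_C_mul_X_pow_le _ _).trans_lt ?_
    have := i.isLt
    exact_mod_cast (by omega : d - 1 - (i : ℕ) < d)
  refine natDegree_eq_of_degree_eq_some ?_
  rw [monicPoly, degree_add_eq_left_of_degree_lt, degree_X_pow]
  rwa [degree_X_pow]

theorem monicPoly_eq_of_monic {d : ℕ} {p : A[X]} (hp : p.Monic) (hd : p.natDegree = d) :
    monicPoly d (fun i => p.coeff (d - 1 - i)) = p := by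
  rcases subsingleton_or_nontrivial A with hA | hA
  · exact Subsingleton.elim _ _
  ext j
  rcases lt_trichotomy j d with hj | rfl | hj
  · rw [monicPoly_coeff_of_lt _ hj]
    congr 1
    simp only []
    omega
  · have h1 := (monicPoly_monic j fun i => p.coeff (j - 1 - i)).coeff_natDegree
    rw [monicPoly_natDegree] at h1
    rw [h1, ← hp.coeff_natDegree, hd]
  · rw [coeff_eq_zero_of_natDegree_lt (by rwa [monicPoly_natDegree]),
      coeff_eq_zero_of_natDegree_lt (by rwa [hd])]

theorem monicPoly_map {B : Type*} [CommRing B] (φ : A →+* B) {d : ℕ} (c : Fin d → A) :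
    (monicPoly d c).map φ = monicPoly d fun i => φ (c i) := by
  simp [monicPoly, Polynomial.map_sum]

end MonicPoly

/-! ### Division by distinguished polynomials -/

section Remainder

theorem monicPoly_isDistinguishedAt {σ k : Type*} [CommRing k] {d : ℕ} (ι : Fin d → σ) :
    (monicPoly d fun i => (MvPowerSeries.X (ι i) : MvPowerSeries σ k)).IsDistinguishedAt
      (Ideal.span (Set.range MvPowerSeries.X)) where
  monic := monicPoly_monic _ _
  mem {j} hj := by
    rcases subsingleton_or_nontrivial k with hk | hk
    · have : Subsingleton (MvPowerSeries σ k) := ⟨fun a b => by ext; exact Subsingleton.elim _ _⟩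
      rw [Subsingleton.elim (coeff _ _) 0]
      exact zero_mem _
    rw [monicPoly_natDegree] at hj
    rw [monicPoly_coeff_of_lt _ hj]
    exact Ideal.subset_span ⟨_, rfl⟩

variable {A : Type*} [CommRing A] {h : A[X]} {I : Ideal A}

theorem _root_.Polynomial.IsDistinguishedAt.order_toNat_eq (H : h.IsDistinguishedAt I)
    (hI : I ≠ ⊤) :
    ((h : PowerSeries A).map (Ideal.Quotient.mk I)).order.toNat = h.natDegree :=
  (congr(ENat.toNat $(H.coe_natDegree_eq_order_map h 1
    (by rwa [PowerSeries.constantCoeff_one, ← Ideal.ne_top_iff_one]) (by simp)))).symm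

/-- Over an adically complete ring, division by a distinguished polynomial extends from
polynomials to power series. -/
theorem exists_remainder (H : h.IsDistinguishedAt I) [IsAdicComplete I A] :
    ∃ L : PowerSeries A →ₗ[A] A[X], (∀ q, L (h * q) = 0) ∧ ∀ P : A[X], L P = P %ₘ h := by
  rcases subsingleton_or_nontrivial A with hA | hA
  · exact ⟨0, fun q => rfl, fun P => Subsingleton.elim _ _⟩
  have hI : I ≠ ⊤ := by
    rintro rfl
    exact not_subsingleton A (‹IsAdicComplete ⊤ A›.subsingleton)
  have H' := H.isWeierstrassDivisorAt hI
  have h0 (q : PowerSeries A) : H'.mod (h * q) = 0 := by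
    rw [← H'.mod'_mk_eq_mod, Ideal.Quotient.eq_zero_iff_mem.2, map_zero]
    exact Ideal.mul_mem_right _ _ (Ideal.mem_span_singleton_self _)
  refine ⟨⟨⟨fun p => H'.mod p, fun _ _ => H'.mod_add _ _⟩, fun _ _ => H'.mod_smul _ _⟩, h0,
    fun P => ?_⟩
  change H'.mod P = P %ₘ h
  conv_lhs => rw [← modByMonic_add_div P h]
  rw [coe_add, H'.mod_add, coe_mul, h0, add_zero]
  refine H'.mod_coe_eq_self ?_
  rw [H.order_toNat_eq hI, ← degree_eq_natDegree H.monic.ne_zero]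
  exact degree_modByMonic_lt _ H.monic

/-- The existence part of Weierstrass division by a distinguished polynomial. -/
theorem exists_degree_lt_sub_mem_span (H : h.IsDistinguishedAt I) [IsAdicComplete I A]
    (p : PowerSeries A) :
    ∃ P : A[X], P.degree < h.natDegree ∧ p - P ∈ Ideal.span {(h : PowerSeries A)} := by
  rcases subsingleton_or_nontrivial A with hA | hA
  · exact ⟨0, by simp, by rw [Subsingleton.elim (p - _) 0]; exact zero_mem _⟩
  have hI : I ≠ ⊤ := by
    rintro rfl
    exact not_subsingleton A (‹IsAdicComplete ⊤ A›.subsingleton)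
  have H' := H.isWeierstrassDivisorAt hI
  obtain ⟨h1, h2⟩ := H'.isWeierstrassDivisionAt_div_mod p
  refine ⟨_, by rwa [H.order_toNat_eq hI] at h1, ?_⟩
  have h3 : p - (H'.mod p : PowerSeries A) = h * H'.div p := by
    rw [sub_eq_iff_eq_add]; exact h2
  rw [h3]
  exact Ideal.mul_mem_right _ _ (Ideal.mem_span_singleton_self _)

theorem sum_coeff_smul_mk_X_pow {f₀ f₁ P : A[X]} {d : ℕ} (hP : P.degree < d) :
    ∑ t : Fin d, P.coeff t • (Ideal.Quotient.mk _ (PowerSeries.X ^ (t : ℕ)) : InterRing f₀ f₁) =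
      Ideal.Quotient.mk _ (P : PowerSeries A) := by
  have h2 : (P : PowerSeries A) = ∑ t : Fin d, P.coeff t • PowerSeries.X ^ (t : ℕ) := by
    ext n
    rw [coeff_coe, map_sum]
    simp only [PowerSeries.coeff_smul, PowerSeries.coeff_X_pow, smul_eq_mul, mul_ite, mul_one,
      mul_zero]
    rcases lt_or_ge n d with hn | hn
    · rw [Finset.sum_eq_single ⟨n, hn⟩]
      · simp
      · exact fun t _ ht => if_neg fun h => ht (Fin.ext h.symm)
      · simp
    · rw [Finset.sum_eq_zero fun t _ => if_neg (by have := t.2; omega),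
        coeff_eq_zero_of_degree_lt (hP.trans_le (by exact_mod_cast hn))]
  rw [h2, map_sum]
  rfl

/-- The powers of the coordinate below the degree generate the coordinate ring of the
intersection. -/
theorem span_range_X_pow_eq_top {f₀ f₁ : A[X]} (H : f₁.IsDistinguishedAt I) [IsAdicComplete I A]
    {d : ℕ} (hd : f₁.natDegree ≤ d) :
    Submodule.span A (Set.range fun t : Fin d =>
      (Ideal.Quotient.mk _ (PowerSeries.X ^ (t : ℕ)) : InterRing f₀ f₁)) = ⊤ := by
  rw [eq_top_iff]
  rintro x -
  obtain ⟨p, rfl⟩ := Ideal.Quotient.mk_surjective x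
  obtain ⟨P, hP, hpP⟩ := exists_degree_lt_sub_mem_span H p
  have h1 : (Ideal.Quotient.mk _ p : InterRing f₀ f₁) =
      Ideal.Quotient.mk _ (P : PowerSeries A) := by
    rw [Ideal.Quotient.mk_eq_mk_iff_sub_mem]
    exact Ideal.span_mono (by simp) hpP
  rw [h1, ← sum_coeff_smul_mk_X_pow (hP.trans_le (by exact_mod_cast hd))]
  exact Submodule.sum_mem _ fun t _ => Submodule.smul_mem _ _ (Submodule.subset_span ⟨t, rfl⟩)

end Remainder

/-! ### Common subdivisors and the Fitting ideal -/

section Factor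

variable {R T : Type*} [CommRing R] [CommRing T] {h : T[X]} {I J : Ideal T}

/-- Multiples of `f` have remainders on division by `h` with coefficients in the ideal that
expresses the divisibility of `f` by `h`. -/
theorem coeff_remainder_mem {L : PowerSeries T →ₗ[T] T[X]} (hL : ∀ q, L (h * q) = 0) {f : T[X]}
    (hf : leIdeal h f ≤ J) (q : PowerSeries T) (i : ℕ) :
    (L (f * q)).coeff i ∈ J := by
  have h1 : (f : PowerSeries T) * q = h * ((f /ₘ h : T[X]) * q) + (f %ₘ h : T[X]) * q := by
    conv_lhs => rw [← modByMonic_add_div f h]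
    rw [coe_add, coe_mul]
    ring
  have h2 : ((f %ₘ h : T[X]) : PowerSeries T) * q =
      ∑ j ∈ Finset.range ((f %ₘ h).natDegree + 1),
        (f %ₘ h).coeff j • (PowerSeries.X ^ j * q) := by
    conv_lhs => rw [(f %ₘ h).as_sum_range_C_mul_X_pow]
    rw [← coeToPowerSeries.ringHom_apply, map_sum, Finset.sum_mul]
    refine Finset.sum_congr rfl fun j _ => ?_
    rw [coeToPowerSeries.ringHom_apply, coe_mul, coe_C, coe_pow, coe_X, PowerSeries.smul_eq_C_mul,
      mul_assoc]
  rw [h1, map_add, hL, zero_add, h2, map_sum, finsetSum_coeff]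
  refine Ideal.sum_mem _ fun j _ => ?_
  rw [map_smul, coeff_smul, smul_eq_mul]
  exact Ideal.mul_mem_right _ _ (hf (Ideal.subset_span ⟨j, rfl⟩))

/-- Where a divisor of degree `r` is contained in both divisors, the intersection multiplicity is
at least `r`. -/
theorem intIdeal_le_comap (H : h.IsDistinguishedAt I) [IsAdicComplete I T] {r : ℕ}
    (hr : h.natDegree = r) (φ : R →+* T) {f₀ f₁ : R[X]} (h₀ : leIdeal h (f₀.map φ) ≤ J)
    (h₁ : leIdeal h (f₁.map φ) ≤ J) : intIdeal f₀ f₁ r ≤ J.comap φ := by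
  obtain ⟨L, hL0, hL⟩ := exists_remainder H
  set ψ : R →+* T ⧸ J := (Ideal.Quotient.mk J).comp φ with hψ
  -- `ν` is the projection of the intersection ring to `(T ⧸ J)⟦x⟧ / h`, in the basis of powers of
  -- `x`, before its factorization through the quotient by `f₀` and `f₁`
  let ν : PowerSeries R →+ (Fin r → T ⧸ J) :=
    { toFun := fun p i => Ideal.Quotient.mk J ((L (PowerSeries.map φ p)).coeff i)
      map_zero' := by ext; simp
      map_add' := fun p q => by ext; simp }
  have hν (p : PowerSeries R) (i : Fin r) :
      ν p i = Ideal.Quotient.mk J ((L (PowerSeries.map φ p)).coeff i) := rfl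
  have hν_smul (a : R) (p : PowerSeries R) (i : Fin r) : ν (a • p) i = ψ a * ν p i := by
    rw [hν, hν, PowerSeries.smul_eq_C_mul, map_mul, PowerSeries.map_C, ← PowerSeries.smul_eq_C_mul,
      map_smul, coeff_smul, smul_eq_mul, map_mul]
    rfl
  have hν_ideal {p : PowerSeries R}
      (hp : p ∈ Ideal.span {(f₀ : PowerSeries R), (f₁ : PowerSeries R)}) : ν p = 0 := by
    obtain ⟨a, b, rfl⟩ := Ideal.mem_span_pair.1 hp
    ext i
    rw [map_add, Pi.add_apply, hν, hν, map_mul (PowerSeries.map φ), map_mul (PowerSeries.map φ),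
      ← Polynomial.polynomial_map_coe, ← Polynomial.polynomial_map_coe, mul_comm,
      mul_comm (PowerSeries.map φ b),
      Ideal.Quotient.eq_zero_iff_mem.2 (coeff_remainder_mem hL0 h₀ _ _),
      Ideal.Quotient.eq_zero_iff_mem.2 (coeff_remainder_mem hL0 h₁ _ _), add_zero]
    rfl
  have hν_X (i j : Fin r) : ν (PowerSeries.X ^ (i : ℕ)) j = if i = j then 1 else 0 := by
    rcases subsingleton_or_nontrivial T with hT | hT
    · have : Subsingleton (T ⧸ J) := Ideal.Quotient.mk_surjective.subsingleton
      exact Subsingleton.elim _ _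
    have h1 : PowerSeries.map φ (PowerSeries.X ^ (i : ℕ)) =
        ((X ^ (i : ℕ) : T[X]) : PowerSeries T) := by
      simp
    rw [hν, h1, hL, (modByMonic_eq_self_iff H.monic).2, coeff_X_pow]
    · simp only [Fin.ext_iff, eq_comm (a := (j : ℕ)), apply_ite (Ideal.Quotient.mk J), map_one,
        map_zero]
    · rw [degree_X_pow, degree_eq_natDegree H.monic.ne_zero, hr]
      exact_mod_cast i.2
  rw [intIdeal, fittingIdeal, Ideal.span_le]
  rintro _ ⟨n, s, e, w, c, hspan, hw, hs, rfl⟩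
  choose ε hε using fun t => Ideal.Quotient.mk_surjective (e t)
  have hv (i : Fin r) : ∃ v : Fin n → R, ∑ t, v t • e t =
      Ideal.Quotient.mk _ (PowerSeries.X ^ (i : ℕ)) := by
    rw [← Submodule.mem_span_range_iff_exists_fun, hspan]
    trivial
  choose v hv using hv
  have hmk (u : Fin n → R) : (∑ t, u t • e t : InterRing f₀ f₁) =
      Ideal.Quotient.mk _ (∑ t, u t • ε t) := by
    rw [map_sum]
    refine Finset.sum_congr rfl fun t _ => ?_
    rw [← hε]
    rfl
  have hνsum (u : Fin n → R) (i : Fin r) : ν (∑ t, u t • ε t) i = ∑ t, ψ (u t) * ν (ε t) i := by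
    rw [map_sum, Finset.sum_apply]
    simp only [hν_smul]
  have key := det_eq_zero_of_relations (S := T ⧸ J) (n := n) (s := s) (r := r) (by omega)
    (Matrix.of fun p q => ψ (w p q)) (Matrix.of fun t i => ν (ε t) i)
    (Matrix.of fun i t => ψ (v i t)) ?_ ?_ c
  · rw [SetLike.mem_coe, Ideal.mem_comap, ← Ideal.Quotient.eq_zero_iff_mem]
    change ψ _ = 0
    rw [RingHom.map_det]
    exact key
  · ext p i
    rw [Matrix.mul_apply]
    simp only [Matrix.of_apply]
    rw [← hνsum, hν_ideal]
    · rfl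
    · rw [← Ideal.Quotient.eq_zero_iff_mem, ← hmk, hw]
  · ext j i
    rw [Matrix.mul_apply]
    simp only [Matrix.of_apply]
    rw [← hνsum, ← sub_eq_zero, Matrix.one_apply, ← hν_X, ← Pi.sub_apply, ← map_sub, hν_ideal]
    · rfl
    · rw [← Ideal.Quotient.eq_zero_iff_mem, map_sub, ← hmk, hv, sub_self]

end Factor

/-! ### Minors in the Fitting ideal -/

section Span

/-- The minors used in the spanning argument: the rows are the remainders of `x ^ p * f₀`. -/
theorem det_coeff_mem_intIdeal {R : Type*} [CommRing R] {I : Ideal R} [IsAdicComplete I R]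
    {f₀ f₁ : R[X]} (H : f₁.IsDistinguishedAt I) {d r : ℕ} (hd : f₁.natDegree ≤ d) (hr : r ≤ d)
    (c : Fin (d - r + 1) → Fin d) :
    (Matrix.of fun p q : Fin (d - r + 1) => ((X ^ (p : ℕ) * f₀) %ₘ f₁).coeff (c q)).det ∈
      intIdeal f₀ f₁ r := by
  refine Ideal.subset_span ⟨d, d - r + 1, _,
    fun p t => ((X ^ (p : ℕ) * f₀) %ₘ f₁).coeff t, c, span_range_X_pow_eq_top H hd, fun p => ?_,
    by omega, rfl⟩
  rcases subsingleton_or_nontrivial R with hR | hR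
  · have : Subsingleton (PowerSeries R) := ⟨fun a b => by ext; exact Subsingleton.elim _ _⟩
    have : Subsingleton (InterRing f₀ f₁) := Ideal.Quotient.mk_surjective.subsingleton
    exact Subsingleton.elim _ _
  set P : R[X] := (X ^ (p : ℕ) * f₀) %ₘ f₁ with hP
  have hdeg : P.degree < d := (degree_modByMonic_lt _ H.monic).trans_le <| by
    rw [degree_eq_natDegree H.monic.ne_zero]
    exact_mod_cast hd
  rw [sum_coeff_smul_mk_X_pow hdeg, Ideal.Quotient.eq_zero_iff_mem]
  have h1 := modByMonic_add_div (X ^ (p : ℕ) * f₀) f₁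
  have h2 : P = X ^ (p : ℕ) * f₀ - f₁ * ((X ^ (p : ℕ) * f₀) /ₘ f₁) := by
    rw [hP]; linear_combination h1
  rw [h2, coe_sub, coe_mul, coe_mul]
  exact Ideal.sub_mem _ (Ideal.mul_mem_left _ _ (Ideal.subset_span (by simp)))
    (Ideal.mul_mem_right _ _ (Ideal.subset_span (by simp)))

end Span

/-! ### Bounded exponents -/

section Exponents

instance finite_exponents (r D : ℕ) : Finite {α : Fin r → ℕ // ∑ t, α t ≤ D} := by
  refine Finite.of_injective (β := Fin r → Fin (D + 1)) (fun α t => ⟨α.1 t, Nat.lt_succ_of_le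
    ((Finset.single_le_sum (fun _ _ => Nat.zero_le _) (Finset.mem_univ t)).trans α.2)⟩) ?_
  intro α β h
  ext t
  exact congrArg (fun f => ((f t : Fin (D + 1)) : ℕ)) h

noncomputable instance (r D : ℕ) : Fintype {α : Fin r → ℕ // ∑ t, α t ≤ D} := Fintype.ofFinite _

/-- Products of at most `m` of the elements `u 0, …, u (r - 1)` are monomials of degree at most `m`
in the reversed list of these elements. -/
theorem exists_prod_pow_eq {Z : Type*} [CommRing Z] (u : ℕ → Z) {r m : ℕ} {s : Multiset ℕ}
    (hs : ∀ x ∈ s, x < r) (hm : s.card ≤ m) :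
    ∃ α : {α : Fin r → ℕ // ∑ t, α t ≤ m},
      (s.map u).prod = ∏ t : Fin r, u (r - 1 - t) ^ α.1 t := by
  have hrev (t : Fin r) : r - 1 - (t : ℕ) = (Fin.revPerm t : Fin r) := by
    rw [Fin.revPerm_apply, Fin.val_rev]
    omega
  refine ⟨⟨fun t => s.count (r - 1 - t), ?_⟩, ?_⟩
  · refine le_trans (le_of_eq ?_) hm
    simp only [hrev]
    rw [Equiv.sum_comp Fin.revPerm fun t : Fin r => s.count (t : ℕ),
      ← Finset.sum_range fun j => s.count j]
    exact Multiset.sum_count_eq_card fun x hx => Finset.mem_range.2 (hs x hx)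
  · simp only [hrev]
    rw [Equiv.prod_comp Fin.revPerm fun t : Fin r => u t ^ s.count (t : ℕ),
      ← Finset.prod_range fun j => u j ^ s.count j, Finset.prod_multiset_map_count]
    refine Finset.prod_subset (fun x hx => Finset.mem_range.2 (hs x (Multiset.mem_toFinset.1 hx)))
      fun x _ hx => ?_
    rw [Multiset.count_eq_zero_of_notMem (fun h => hx (Multiset.mem_toFinset.2 h)), pow_zero]

end Exponents

/-! ### Generators modulo the variables of the coefficient ring -/

section Spanning

theorem modByMonic_X_pow_coeff {A : Type*} [CommRing A] (P : A[X]) {d j : ℕ} (hj : j < d) :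
    (P %ₘ X ^ d).coeff j = P.coeff j := by
  conv_rhs => rw [← modByMonic_add_div P (X ^ d)]
  rw [coeff_add, coeff_X_pow_mul', if_neg (by omega), add_zero]

/-- A power of the ideal of the variables maps to zero as soon as the monomials of that degree do. -/
theorem span_range_X_pow_le_ker {σ k Z : Type*} [CommRing k] [CommRing Z]
    (π : MvPowerSeries σ k →+* Z) {D : ℕ}
    (h : ∀ V : Multiset σ, V.card = D → (V.map fun v => π (MvPowerSeries.X v)).prod = 0) :
    (Ideal.span (Set.range MvPowerSeries.X) : Ideal (MvPowerSeries σ k)) ^ D ≤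
      RingHom.ker π := by
  rw [Ideal.span, Submodule.span_pow, Submodule.span_le]
  intro x hx
  obtain ⟨f, rfl⟩ := Set.mem_pow.1 hx
  choose v hv using fun i => (f i).2
  rw [SetLike.mem_coe, RingHom.mem_ker, map_list_prod, List.map_ofFn]
  have := h (Multiset.ofList (List.ofFn v)) (by simp)
  rw [Multiset.map_coe, Multiset.prod_coe, List.map_ofFn] at this
  rw [← this]
  congr 2
  ext i
  simp [hv]

variable (k : Type*) [CommRing k] {d₀ d₁ r : ℕ}

theorem coeffToPair_toRingHom_X (v : Fin (d₀ - r) ⊕ Fin d₁) :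
    (coeffToPair k d₀ d₁ r).toRingHom (MvPowerSeries.X v) =
      MvPowerSeries.X (Sum.map (Fin.castLE (Nat.sub_le d₀ r)) id v) :=
  MvPowerSeries.rename_X _ _

/-- Modulo the variables of the coefficient ring and finitely many elements of the Fitting ideal,
the monomials of degree at most `d₁ - r` in the top coefficients span. -/
theorem exists_sub_sum_mem (h₀ : r ≤ d₀) (h₁ : r ≤ d₁)
    (p : DivPairRing k d₀ d₁) :
    ∃ (b : {α : Fin r → ℕ // ∑ t, α t ≤ d₁ - r} → k)
      (q : (Fin (d₁ - r + 1) → Fin d₁) → DivPairRing k d₀ d₁),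
      p - (∑ α, algebraMap k (DivPairRing k d₀ d₁) (b α) *
            ∏ t, (MvPowerSeries.X (Sum.inl ⟨d₀ - r + (t : ℕ), by omega⟩)) ^ α.1 t +
          ∑ c, q c * (Matrix.of fun x y : Fin (d₁ - r + 1) =>
            ((X ^ (x : ℕ) * pairPoly₀ k d₀ d₁) %ₘ pairPoly₁ k d₀ d₁).coeff (c y)).det) ∈
        (Ideal.span (Set.range MvPowerSeries.X)).map (coeffToPair k d₀ d₁ r).toRingHom := by
  rcases subsingleton_or_nontrivial k with hk | hk
  · have : Subsingleton (DivPairRing k d₀ d₁) := ⟨fun a b => by ext; exact Subsingleton.elim _ _⟩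
    refine ⟨0, 0, ?_⟩
    rw [Subsingleton.elim (p - _) 0]
    exact zero_mem _
  set f₀ := pairPoly₀ k d₀ d₁ with hf₀
  set f₁ := pairPoly₁ k d₀ d₁ with hf₁
  set g : (Fin (d₁ - r + 1) → Fin d₁) → DivPairRing k d₀ d₁ := fun c =>
    (Matrix.of fun x y : Fin (d₁ - r + 1) => ((X ^ (x : ℕ) * f₀) %ₘ f₁).coeff (c y)).det with hg
  set Y := (Ideal.span (Set.range MvPowerSeries.X)).map (coeffToPair k d₀ d₁ r).toRingHom with hY
  set K := Ideal.span (Set.range g) ⊔ Y with hK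
  -- in the quotient by `K` only the `r` top coefficients of `f₀` survive, and `f₁` becomes `X ^ d₁`
  let π := Ideal.Quotient.mkₐ k K
  have hπ {x : DivPairRing k d₀ d₁} : π x = 0 ↔ x ∈ K := Ideal.Quotient.eq_zero_iff_mem
  have hcoeff {j : ℕ} (hj : j < d₀) :
      f₀.coeff j = MvPowerSeries.X (Sum.inl ⟨d₀ - 1 - j, by omega⟩) := monicPoly_coeff_of_lt _ hj
  have hX_small {i : Fin d₀} (hi : (i : ℕ) < d₀ - r) :
      π (MvPowerSeries.X (Sum.inl i)) = 0 := by
    rw [hπ]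
    refine Ideal.mem_sup_right ?_
    have := Ideal.mem_map_of_mem (coeffToPair k d₀ d₁ r).toRingHom
      (Ideal.subset_span ⟨Sum.inl ⟨i, hi⟩, rfl⟩ : MvPowerSeries.X (Sum.inl ⟨i, hi⟩) ∈
        (Ideal.span (Set.range MvPowerSeries.X) : Ideal (CoeffRing k d₀ d₁ r)))
    rwa [coeffToPair_toRingHom_X] at this
  have hX_inr (j : Fin d₁) : π (MvPowerSeries.X (Sum.inr j)) = 0 := by
    rw [hπ]
    refine Ideal.mem_sup_right ?_
    have := Ideal.mem_map_of_mem (coeffToPair k d₀ d₁ r).toRingHom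
      (Ideal.subset_span ⟨Sum.inr j, rfl⟩ : MvPowerSeries.X (Sum.inr j) ∈
        (Ideal.span (Set.range MvPowerSeries.X) : Ideal (CoeffRing k d₀ d₁ r)))
    rwa [coeffToPair_toRingHom_X] at this
  let u (j : ℕ) := π (f₀.coeff j)
  have hu0 (j : ℕ) (hrj : r ≤ j) (hjd : j ≠ d₀) : u j = 0 := by
    rcases lt_or_gt_of_ne hjd with hj | hj
    · simp only [u]
      rw [hcoeff hj]
      exact hX_small (by simp only []; omega)
    · simp only [u]
      rw [coeff_eq_zero_of_natDegree_lt, map_zero]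
      rwa [hf₀, pairPoly₀, monicPoly_natDegree]
  have hud : u d₀ = 1 := by
    have := (monicPoly_monic d₀ fun i => (MvPowerSeries.X (Sum.inl i) :
      DivPairRing k d₀ d₁)).coeff_natDegree
    rw [monicPoly_natDegree] at this
    simp only [u]
    rw [hf₀, pairPoly₀, this, map_one]
  have hf₁m : f₁.Monic := monicPoly_monic _ _
  have hf₁map : f₁.map π.toRingHom = X ^ d₁ := by
    rw [hf₁, pairPoly₁, monicPoly_map]
    simp [monicPoly, hX_inr]
  have hdet (c : Fin (d₁ - r + 1) → ℕ) (hc : StrictMono c)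
      (hcr : ∀ q, c q < d₁ - r + 1 - 1 + r) :
      (Matrix.of fun p q : Fin (d₁ - r + 1) =>
        if (p : ℕ) ≤ c q then u (c q - p) else 0).det = 0 := by
    have h1 : π (g fun q => ⟨c q, by have := hcr q; omega⟩) = 0 :=
      hπ.2 (Ideal.mem_sup_left (Ideal.subset_span ⟨_, rfl⟩))
    simp only [hg] at h1
    rw [AlgHom.map_det] at h1
    refine Eq.trans (congrArg Matrix.det ?_) h1
    ext x y
    simp only [Matrix.of_apply, AlgHom.mapMatrix_apply, Matrix.map_apply]
    have h2 := coeff_map (p := (X ^ (x : ℕ) * f₀) %ₘ f₁) π.toRingHom (c y)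
    rw [map_modByMonic _ hf₁m, hf₁map, modByMonic_X_pow_coeff _
      (by have := hcr y; omega), Polynomial.map_mul, Polynomial.map_pow, map_X,
      coeff_X_pow_mul'] at h2
    refine Eq.trans ?_ h2
    simp [u]
  have hvar (v : Fin d₀ ⊕ Fin d₁) : π (MvPowerSeries.X v) = 0 ∨
      ∃ e < r, π (MvPowerSeries.X v) = u e := by
    rcases v with i | j
    · rcases lt_or_ge (i : ℕ) (d₀ - r) with hi | hi
      · exact Or.inl (hX_small hi)
      · have := i.2
        refine Or.inr ⟨d₀ - 1 - i, by omega, ?_⟩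
        simp only [u]
        rw [hcoeff (by omega)]
        congr 3
        ext
        simp only []
        omega
    · exact Or.inl (hX_inr j)
  have hvars (V : Multiset (Fin d₀ ⊕ Fin d₁)) :
      (V.map fun v => π (MvPowerSeries.X v)).prod = 0 ∨ ∃ s : Multiset ℕ, s.card = V.card ∧
        (∀ x ∈ s, x < r) ∧ (V.map fun v => π (MvPowerSeries.X v)).prod = (s.map u).prod := by
    induction V using Multiset.induction with
    | empty => exact Or.inr ⟨0, by simp⟩
    | cons v V ih =>
      rw [Multiset.map_cons, Multiset.prod_cons]
      rcases hvar v with h | ⟨e, he, h⟩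
      · left; rw [h, zero_mul]
      rcases ih with ih | ⟨s, hs, hsr, ih⟩
      · left; rw [ih, mul_zero]
      · refine Or.inr ⟨e ::ₘ s, by simp [hs], ?_, by rw [h, ih]; simp⟩
        intro x hx
        rcases Multiset.mem_cons.1 hx with rfl | hx
        exacts [he, hsr x hx]
  let mon (α : {α : Fin r → ℕ // ∑ t, α t ≤ d₁ - r}) : DivPairRing k d₀ d₁ :=
    ∏ t : Fin r, (MvPowerSeries.X (Sum.inl ⟨d₀ - r + (t : ℕ), by omega⟩)) ^ α.1 t
  have hmon (α : {α : Fin r → ℕ // ∑ t, α t ≤ d₁ - r}) :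
      π (mon α) = ∏ t : Fin r, u (r - 1 - t) ^ α.1 t := by
    simp only [mon, map_prod, map_pow, u]
    refine Finset.prod_congr rfl fun t _ => ?_
    have := t.2
    rw [hcoeff (by omega)]
    congr 4
    ext
    simp only []
    omega
  set M := Submodule.span k (Set.range fun α => π (mon α)) with hM
  have hmem (V : Multiset (Fin d₀ ⊕ Fin d₁)) :
      (V.map fun v => π (MvPowerSeries.X v)).prod ∈ M := by
    rcases hvars V with h | ⟨s, -, hs, h⟩
    · rw [h]; exact zero_mem _
    · rw [h]
      refine (AddSubgroup.closure_le M.toAddSubgroup).2 ?_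
        (multiset_prod_mem_closure_card_lt hu0 hud hdet s)
      rintro _ ⟨t, ht, htm, rfl⟩
      obtain ⟨α, hα⟩ := exists_prod_pow_eq u ht (Nat.le_of_lt_succ htm)
      rw [hα, ← hmon]
      exact Submodule.subset_span ⟨α, rfl⟩
  -- the surviving coefficients are nilpotent, so that a power series may be truncated
  set D := d₁ * d₀ + 1 with hD
  have hker := span_range_X_pow_le_ker π.toRingHom (D := D) fun V hV => by
    rcases hvars V with h | ⟨s, hsV, hs, h⟩
    · exact h
    · refine h.trans (multiset_prod_eq_zero hu0 hud h₀ (Nat.succ_pos _) hdet s hs ?_)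
      rw [hsV, hV, hD]
      exact Nat.lt_succ_of_le (Nat.mul_le_mul_right _ (by omega))
  have hpM : π p ∈ M := by
    have h1 := hker (sub_truncTotal_mem D p)
    rw [RingHom.mem_ker, map_sub, sub_eq_zero] at h1
    change π p = π _ at h1
    rw [h1]
    generalize p.truncTotal D = P
    have h2 : π (P : DivPairRing k d₀ d₁) =
        MvPolynomial.aeval (fun v => π (MvPowerSeries.X v)) P := by
      have : π.comp (MvPolynomial.coeToMvPowerSeries.algHom k) =
          MvPolynomial.aeval fun v => π (MvPowerSeries.X v) := by
        ext v
        simp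
      simpa using DFunLike.congr_fun this P
    rw [h2, MvPolynomial.aeval_def, MvPolynomial.eval₂_eq]
    refine Submodule.sum_mem _ fun s _ => ?_
    rw [← Algebra.smul_def]
    refine Submodule.smul_mem _ _ ?_
    convert hmem (Finsupp.toMultiset s) using 1
    classical
    rw [Finset.prod_multiset_map_count, Finsupp.toFinset_toMultiset]
    simp only [Finsupp.count_toMultiset]
  obtain ⟨b, hb⟩ := (Submodule.mem_span_range_iff_exists_fun k).1 hpM
  have hmem' : p - ∑ α, algebraMap k (DivPairRing k d₀ d₁) (b α) * mon α ∈ K := by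
    rw [← hπ, map_sub, ← hb, map_sum, sub_eq_zero]
    refine Finset.sum_congr rfl fun α _ => ?_
    rw [map_mul, AlgHom.commutes, Algebra.smul_def]
  obtain ⟨y, hy, z, hz, hyz⟩ := Submodule.mem_sup.1 hmem'
  obtain ⟨q, rfl⟩ := Ideal.mem_span_range_iff_exists_fun.1 hy
  refine ⟨b, q, ?_⟩
  convert hz using 1
  linear_combination -hyz

end Spanning

/-! ### Generators of the coordinate ring of the intersection scheme -/

section Generation

variable (k : Type*) [CommRing k] {d₀ d₁ r : ℕ}

/-- Every function on pairs of divisors is a `CoeffRing`-combination of the monomials in the top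
coefficients, up to elements of the Fitting ideal. -/
theorem exists_eq_sum_coeffToPair (h₀ : r ≤ d₀) (h₁ : r ≤ d₁) (p : DivPairRing k d₀ d₁) :
    ∃ (b : {α : Fin r → ℕ // ∑ t, α t ≤ d₁ - r} → CoeffRing k d₀ d₁ r)
      (q : (Fin (d₁ - r + 1) → Fin d₁) → DivPairRing k d₀ d₁),
      p = ∑ α, coeffToPair k d₀ d₁ r (b α) *
            ∏ t, (MvPowerSeries.X (Sum.inl ⟨d₀ - r + (t : ℕ), by omega⟩)) ^ α.1 t +
          ∑ c, q c * (Matrix.of fun x y : Fin (d₁ - r + 1) =>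
            ((X ^ (x : ℕ) * pairPoly₀ k d₀ d₁) %ₘ pairPoly₁ k d₀ d₁).coeff (c y)).det := by
  let _ : Algebra (CoeffRing k d₀ d₁ r) (DivPairRing k d₀ d₁) :=
    (coeffToPair k d₀ d₁ r).toRingHom.toAlgebra
  have hYP : (Ideal.span (Set.range MvPowerSeries.X)).map
      (coeffToPair k d₀ d₁ r).toRingHom ≤
      Ideal.span (Set.range MvPowerSeries.X) := by
    rw [Ideal.map_span, Ideal.span_le]
    rintro _ ⟨_, ⟨v, rfl⟩, rfl⟩
    rw [coeffToPair_toRingHom_X]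
    exact Ideal.subset_span ⟨_, rfl⟩
  refine exists_eq_sum_add_sum (Ideal.span (Set.range MvPowerSeries.X))
    (Ideal.span (Set.range MvPowerSeries.X)) hYP _ _ (fun p => ?_) p
  obtain ⟨b, q, h⟩ := exists_sub_sum_mem k h₀ h₁ p
  refine ⟨fun α => algebraMap k _ (b α), q, ?_⟩
  have (a : k) : (coeffToPair k d₀ d₁ r).toRingHom (algebraMap k _ a) =
          algebraMap k _ a := (coeffToPair k d₀ d₁ r).commutes a
  rw [RingHom.algebraMap_toAlgebra]
  simp only [this]
  exact h

/-- The monomials of degree at most `d₁ - r` in the top coefficients span the coordinate ring of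
`Int_r(d₀, d₁)`. -/
theorem exists_intMk_eq_sum (h₀ : r ≤ d₀) (h₁ : r ≤ d₁) (p : DivPairRing k d₀ d₁) :
    ∃ b : {α : Fin r → ℕ // ∑ t, α t ≤ d₁ - r} → CoeffRing k d₀ d₁ r,
      intMk k d₀ d₁ r p = ∑ α, b α • ∏ t, topCoeff k d₁ h₀ t ^ α.1 t := by
  rcases subsingleton_or_nontrivial k with hk | hk
  · have : Subsingleton (DivPairRing k d₀ d₁) := ⟨fun a b => by ext; exact Subsingleton.elim _ _⟩
    have : Subsingleton (IntRing k d₀ d₁ r) := Ideal.Quotient.mk_surjective.subsingleton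
    exact ⟨0, Subsingleton.elim _ _⟩
  obtain ⟨b, q, h⟩ := exists_eq_sum_coeffToPair k h₀ h₁ p
  refine ⟨b, ?_⟩
  have hdist : (pairPoly₁ k d₀ d₁).IsDistinguishedAt (Ideal.span (Set.range MvPowerSeries.X)) :=
    monicPoly_isDistinguishedAt Sum.inr
  have hzero (c : Fin (d₁ - r + 1) → Fin d₁) : intMk k d₀ d₁ r
      (Matrix.of fun x y : Fin (d₁ - r + 1) =>
        ((X ^ (x : ℕ) * pairPoly₀ k d₀ d₁) %ₘ pairPoly₁ k d₀ d₁).coeff (c y)).det = 0 :=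
    Ideal.Quotient.eq_zero_iff_mem.2 (det_coeff_mem_intIdeal hdist
      (monicPoly_natDegree _).le h₁ c)
  rw [h, map_add, map_sum, map_sum]
  simp only [map_mul, hzero, mul_zero, Finset.sum_const_zero, add_zero, map_prod, map_pow]
  refine Finset.sum_congr rfl fun α _ => ?_
  rw [Algebra.smul_def]
  rfl

end Generation

/-! ### Algebras of independent roots -/

section Splitting

universe u

/-- An algebra generated by `r` independent roots of a monic polynomial `f`. It is free, and a basis
is formed by the monomials with all exponents smaller than the degree of `f`. -/
theorem exists_algebra_roots {B : Type u} [CommRing B] [Nontrivial B] {f : B[X]} (hf : f.Monic)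
    (r : ℕ) (hr : r ≤ f.natDegree) :
    ∃ (E : Type u) (_ : CommRing E) (_ : Algebra B E) (x : Fin r → E)
      (b : Module.Basis (Fin r → Fin f.natDegree) B E),
      (∀ e, b e = ∏ i, x i ^ (e i : ℕ)) ∧ ∀ i, aeval (x i) f = 0 := by
  induction r with
  | zero =>
    exact ⟨B, inferInstance, inferInstance, Fin.elim0, Module.Basis.singleton _ B,
      fun e => by simp, fun i => i.elim0⟩
  | succ r ih =>
    obtain ⟨E, _, _, x, b, hb, hx⟩ := ih (Nat.le_of_succ_le hr)
    have : Nontrivial E := ⟨b fun _ => ⟨0, by omega⟩, 0, b.ne_zero _⟩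
    set g := f.map (algebraMap B E) with hg
    have hgm : g.Monic := hf.map _
    let pb := AdjoinRoot.powerBasis' hgm
    have hdim : pb.dim = f.natDegree := by
      rw [AdjoinRoot.powerBasis'_dim, hg, hf.natDegree_map]
    let ε : (Fin r → Fin f.natDegree) × Fin pb.dim ≃ (Fin (r + 1) → Fin f.natDegree) :=
      ((Equiv.refl _).prodCongr (finCongr hdim)).trans
        ((Equiv.prodComm _ _).trans (Fin.consEquiv fun _ => Fin f.natDegree))
    refine ⟨AdjoinRoot g, inferInstance, inferInstance,
      Fin.cons (AdjoinRoot.root g) fun i => algebraMap E _ (x i),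
      (b.smulTower pb.basis).reindex ε, fun e => ?_, fun i => ?_⟩
    · have h1 : ε.symm e = (fun i => e i.succ, Fin.cast hdim.symm (e 0)) := rfl
      rw [Module.Basis.reindex_apply, h1, Module.Basis.smulTower_apply, hb, Fin.prod_univ_succ,
        pb.coe_basis, AdjoinRoot.powerBasis'_gen]
      simp only [Fin.cons_zero, Fin.cons_succ, Algebra.smul_def, map_prod, map_pow]
      rw [mul_comm]
      rfl
    · refine Fin.cases ?_ (fun i => ?_) i
      · rw [Fin.cons_zero, ← Polynomial.aeval_map_algebraMap E, ← hg]
        rw [aeval_def, AdjoinRoot.algebraMap_eq, AdjoinRoot.eval₂_root]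
      · rw [Fin.cons_succ, aeval_algebraMap_apply, hx, map_zero]

end Splitting

/-! ### Alternants -/

section Alternants

variable {A A' : Type*} [CommRing A] [CommRing A'] {r n : ℕ}

/-- The multiple of `∏ i, (X - x i)` that differs from
`X ^ d + c 0 * X ^ (d - 1) + ... + c (n - 1) * X ^ (d - n)` by a polynomial of degree less
than `r`. -/
noncomputable def rootMultiple (d : ℕ) (x : Fin r → A) (c : Fin n → A) : A[X] :=
  (X ^ d + ∑ i : Fin n, C (c i) * X ^ (d - 1 - (i : ℕ))) -
    (X ^ d + ∑ i : Fin n, C (c i) * X ^ (d - 1 - (i : ℕ))) %ₘ ∏ i, (X - C (x i))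

theorem prod_X_sub_C_monic (x : Fin r → A) : (∏ i, (X - C (x i))).Monic :=
  monic_prod_of_monic _ _ fun i _ => monic_X_sub_C (x i)

theorem prod_X_sub_C_natDegree [Nontrivial A] (x : Fin r → A) :
    (∏ i, (X - C (x i))).natDegree = r := by
  rw [natDegree_prod_of_monic _ _ fun i _ => monic_X_sub_C (x i)]
  simp

theorem prod_X_sub_C_map (φ : A →+* A') (x : Fin r → A) :
    (∏ i, (X - C (x i))).map φ = ∏ i, (X - C (φ (x i))) := by
  simp [Polynomial.map_prod]

theorem rootMultiple_map (φ : A →+* A') (d : ℕ) (x : Fin r → A) (c : Fin n → A) :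
    (rootMultiple d x c).map φ = rootMultiple d (fun i => φ (x i)) fun i => φ (c i) := by
  rw [rootMultiple, Polynomial.map_sub, map_modByMonic _ (prod_X_sub_C_monic x),
    prod_X_sub_C_map, rootMultiple]
  simp [Polynomial.map_sum]

theorem dvd_rootMultiple (d : ℕ) (x : Fin r → A) (c : Fin n → A) :
    ∏ i, (X - C (x i)) ∣ rootMultiple d x c := by
  rw [rootMultiple]
  refine ⟨_, sub_eq_of_eq_add' (modByMonic_add_div _ _).symm⟩

theorem rootMultiple_coeff [Nontrivial A] {d j : ℕ} (x : Fin r → A) (c : Fin n → A) (hj : r ≤ j) :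
    (rootMultiple d x c).coeff j =
      (X ^ d + ∑ i : Fin n, C (c i) * X ^ (d - 1 - (i : ℕ))).coeff j := by
  rw [rootMultiple, coeff_sub, sub_eq_self]
  refine coeff_eq_zero_of_degree_lt ((degree_modByMonic_lt _ (prod_X_sub_C_monic x)).trans_le ?_)
  rw [degree_eq_natDegree (prod_X_sub_C_monic x).ne_zero, prod_X_sub_C_natDegree]
  exact_mod_cast hj

theorem rootMultiple_coeff_eq [Nontrivial A] {d : ℕ} (h : n + r = d) (x : Fin r → A)
    (c : Fin n → A) (i : Fin n) : (rootMultiple d x c).coeff (d - 1 - i) = c i := by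
  have hi := i.2
  rw [rootMultiple_coeff x c (by omega), coeff_add, coeff_X_pow, if_neg (by omega), zero_add,
    finsetSum_coeff, Finset.sum_eq_single i]
  · rw [coeff_C_mul_X_pow, if_pos rfl]
  · intro j _ hj
    have := j.2
    rw [coeff_C_mul_X_pow, if_neg]
    intro h'
    exact hj (Fin.ext (by omega))
  · simp

theorem rootMultiple_monic_natDegree [Nontrivial A] {d : ℕ} (h : n + r = d) (x : Fin r → A)
    (c : Fin n → A) : (rootMultiple d x c).Monic ∧ (rootMultiple d x c).natDegree = d := by
  set G : A[X] := ∑ i : Fin n, C (c i) * X ^ (d - 1 - (i : ℕ)) with hG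
  set h := ∏ i, (X - C (x i)) with hh
  have hdeg : (G - (X ^ d + G) %ₘ h).degree < (d : WithBot ℕ) := by
    refine (degree_sub_le _ _).trans_lt (max_lt ?_ ?_)
    · refine (degree_sum_le _ _).trans_lt ?_
      rw [Finset.sup_lt_iff (by exact_mod_cast WithBot.bot_lt_coe d)]
      intro i _
      refine (degree_C_mul_X_pow_le _ _).trans_lt ?_
      have := i.isLt
      exact_mod_cast (by omega : d - 1 - (i : ℕ) < d)
    · refine (degree_modByMonic_lt _ (prod_X_sub_C_monic x)).trans_le ?_
      rw [degree_eq_natDegree (prod_X_sub_C_monic x).ne_zero, prod_X_sub_C_natDegree]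
      exact_mod_cast (by omega : r ≤ d)
  have hF : rootMultiple d x c = X ^ d + (G - (X ^ d + G) %ₘ h) := by
    rw [rootMultiple, add_sub_assoc]
  refine ⟨hF ▸ monic_X_pow_add hdeg, natDegree_eq_of_degree_eq_some ?_⟩
  rw [hF, degree_add_eq_left_of_degree_lt, degree_X_pow]
  rwa [degree_X_pow]

/-- The product of the Vandermonde determinant with a monomial in the lower coefficients of
`rootMultiple`. -/
noncomputable def alternant (d : ℕ) (x : Fin r → A) (c : Fin n → A) (α : Fin r → ℕ) : A :=
  (Matrix.vandermonde x).det * ∏ t : Fin r, (rootMultiple d x c).coeff (r - 1 - t) ^ α t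

theorem map_alternant (φ : A →+* A') (d : ℕ) (x : Fin r → A) (c : Fin n → A) (α : Fin r → ℕ) :
    φ (alternant d x c α) = alternant d (fun i => φ (x i)) (fun i => φ (c i)) α := by
  rw [alternant, map_mul, map_prod, RingHom.map_det, alternant, ← rootMultiple_map]
  congr 1
  · congr 1
    ext i j
    simp [Matrix.vandermonde_apply]
  · simp [coeff_map]

/-- Multiplication by the Vandermonde determinant kills the remainder of a polynomial that
vanishes at all the roots, although the remainder itself need not vanish. -/
theorem det_vandermonde_mul_coeff_eq_zero (x : Fin r → A) {f : A[X]} (hf : ∀ i, f.eval (x i) = 0)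
    (j : ℕ) : (Matrix.vandermonde x).det * (f %ₘ ∏ i, (X - C (x i))).coeff j = 0 := by
  rcases subsingleton_or_nontrivial A with hA | hA
  · exact Subsingleton.elim _ _
  set h := ∏ i, (X - C (x i)) with hh
  have hm : h.Monic := prod_X_sub_C_monic x
  have hdeg : (f %ₘ h).degree < r := by
    have := degree_modByMonic_lt f hm
    rwa [degree_eq_natDegree hm.ne_zero, hh, prod_X_sub_C_natDegree] at this
  rcases lt_or_ge j r with hj | hj
  · have h1 : Matrix.mulVec (Matrix.vandermonde x) (fun j : Fin r => (f %ₘ h).coeff j) = 0 := by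
      ext i
      have h2 : (f %ₘ h).eval (x i) = 0 := by
        have h4 : h.eval (x i) = 0 := by
          rw [hh, eval_prod]
          exact Finset.prod_eq_zero (Finset.mem_univ i) (by simp)
        have h3 := congrArg (eval (x i)) (modByMonic_add_div f h)
        rwa [eval_add, eval_mul, hf, h4, zero_mul, add_zero] at h3
      rw [eval_eq_sum_range' (n := r) (by
        rcases eq_or_ne (f %ₘ h) 0 with h0 | h0
        · rw [h0, natDegree_zero]; omega
        · rw [degree_eq_natDegree h0] at hdeg
          exact_mod_cast hdeg), Finset.sum_range] at h2
      simp only [Matrix.mulVec, dotProduct, Matrix.vandermonde_apply, Pi.zero_apply]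
      rw [← h2]
      exact Finset.sum_congr rfl fun _ _ => mul_comm _ _
    have h2 := congrArg (Matrix.mulVec (Matrix.adjugate (Matrix.vandermonde x))) h1
    rw [Matrix.mulVec_mulVec, Matrix.adjugate_mul, Matrix.mulVec_zero, Matrix.smul_mulVec,
      Matrix.one_mulVec] at h2
    exact congrFun h2 ⟨j, hj⟩
  · rw [coeff_eq_zero_of_degree_lt (hdeg.trans_le (by exact_mod_cast hj)), mul_zero]

end Alternants

/-! ### Triples of divisors with given roots -/

section Specialization

theorem prod_X_sub_C_coeff_mem {A : Type*} [CommRing A] {r : ℕ} (I : Ideal A) {x : Fin r → A}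
    (hx : ∀ i, x i ∈ I) {j : ℕ} (hj : j < r) : (∏ i, (X - C (x i))).coeff j ∈ I := by
  have hx' (i : Fin r) : Ideal.Quotient.mk I (x i) = 0 := Ideal.Quotient.eq_zero_iff_mem.2 (hx i)
  rw [← Ideal.Quotient.eq_zero_iff_mem, ← coeff_map, prod_X_sub_C_map]
  simp [hx', coeff_X_pow, hj.ne]

theorem rootMultiple_coeff_mem {A : Type*} [CommRing A] {r n d : ℕ} (hr : r ≤ d) (I : Ideal A)
    {x : Fin r → A} (hx : ∀ i, x i ∈ I) {c : Fin n → A} (hc : ∀ i, c i ∈ I) {j : ℕ} (hj : j < d) :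
    (rootMultiple d x c).coeff j ∈ I := by
  have hx' (i : Fin r) : Ideal.Quotient.mk I (x i) = 0 := Ideal.Quotient.eq_zero_iff_mem.2 (hx i)
  have hc' (i : Fin n) : Ideal.Quotient.mk I (c i) = 0 := Ideal.Quotient.eq_zero_iff_mem.2 (hc i)
  have h : (X ^ d : (A ⧸ I)[X]) %ₘ X ^ r = 0 :=
    (modByMonic_eq_zero_iff_dvd (monic_X_pow r)).2 (pow_dvd_pow _ hr)
  rw [← Ideal.Quotient.eq_zero_iff_mem, ← coeff_map, rootMultiple_map]
  simp [rootMultiple, hx', hc', h, coeff_X_pow, hj.ne]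

theorem pow_mem_of_eval_monicPoly_eq_zero {A : Type*} [CommRing A] {d : ℕ} (I : Ideal A)
    {c : Fin d → A} (hc : ∀ i, c i ∈ I) {y : A} (hy : (monicPoly d c).eval y = 0) : y ^ d ∈ I := by
  rw [monicPoly, eval_add, eval_pow, eval_X, eval_finsetSum] at hy
  rw [eq_neg_of_add_eq_zero_left hy]
  refine neg_mem (sum_mem fun i _ => ?_)
  rw [eval_mul, eval_C]
  exact Ideal.mul_mem_right _ _ (hc i)

variable {k E : Type*} [CommRing k] [CommRing E] [Algebra k E] {d₀ d₁ r : ℕ}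

/-- Topologically nilpotent elements `x i`, `c₀ i`, `c₁ j` of a complete ring `E` define a triple of
divisors with equations `h = ∏ i, (X - x i)`, a multiple of `h` and `monicPoly d₁ c₁`. -/
theorem exists_triple_algHom (J : Ideal E) [IsAdicComplete J E] (hr : r ≤ d₀) {x : Fin r → E}
    (hx : ∀ i, x i ∈ J.radical) {c₀ : Fin (d₀ - r) → E} (h₀ : ∀ i, c₀ i ∈ J) {c₁ : Fin d₁ → E}
    (h₁ : ∀ j, c₁ j ∈ J) :
    ∃ θ : DivTripleRing k d₀ d₁ r →ₐ[k] E,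
      (∀ i : Fin r, θ (MvPowerSeries.X (Sum.inl i)) =
        (∏ i, (X - C (x i))).coeff (r - 1 - i)) ∧
      (∀ i : Fin d₀, θ (MvPowerSeries.X (Sum.inr (Sum.inl i))) =
        (rootMultiple d₀ x c₀).coeff (d₀ - 1 - i)) ∧
      ∀ j : Fin d₁, θ (MvPowerSeries.X (Sum.inr (Sum.inr j))) = c₁ j := by
  obtain ⟨θ, hθ⟩ := exists_algHom_X_eq (k := k) J
    (Sum.elim (fun i : Fin r => (∏ i, (X - C (x i))).coeff (r - 1 - i))
      (Sum.elim (fun i : Fin d₀ => (rootMultiple d₀ x c₀).coeff (d₀ - 1 - i)) c₁)) (by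
    rintro (i | i | j)
    · exact prod_X_sub_C_coeff_mem _ hx (by have := i.2; omega)
    · exact rootMultiple_coeff_mem hr _ hx (fun i => Ideal.le_radical (h₀ i))
        (by have := i.2; omega)
    · exact Ideal.le_radical (h₁ j))
  exact ⟨θ, fun i => hθ _, fun i => hθ _, fun j => hθ _⟩

variable {θ : DivTripleRing k d₀ d₁ r →ₐ[k] E} {x : Fin r → E} {c₀ : Fin (d₀ - r) → E}
  {c₁ : Fin d₁ → E}

/-- Multiplication by the Vandermonde determinant of common roots kills the equations of
`Sub_r(d₀, d₁)`. -/
theorem det_vandermonde_mul_eq_zero [Nontrivial E] (hr : r ≤ d₀)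
    (hθ : ∀ i : Fin r, θ (MvPowerSeries.X (Sum.inl i)) = (∏ i, (X - C (x i))).coeff (r - 1 - i))
    (hθ₀ : ∀ i : Fin d₀, θ (MvPowerSeries.X (Sum.inr (Sum.inl i))) =
      (rootMultiple d₀ x c₀).coeff (d₀ - 1 - i))
    (hθ₁ : ∀ j : Fin d₁, θ (MvPowerSeries.X (Sum.inr (Sum.inr j))) = c₁ j)
    (hx : ∀ i, (monicPoly d₁ c₁).eval (x i) = 0) {z : DivTripleRing k d₀ d₁ r}
    (hz : z ∈ subIdeal k d₀ d₁ r) : (Matrix.vandermonde x).det * θ z = 0 := by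
  have hX (v : Fin d₀ ⊕ Fin d₁) : pairToTriple k d₀ d₁ r (MvPowerSeries.X v) =
      MvPowerSeries.X (Sum.inr v) := MvPowerSeries.rename_X _ _
  have hh : (triplePoly k d₀ d₁ r).map θ.toRingHom = ∏ i, (X - C (x i)) := by
    rw [triplePoly, monicPoly_map]
    simp only [AlgHom.toRingHom_eq_coe, RingHom.coe_coe, hθ]
    exact monicPoly_eq_of_monic (prod_X_sub_C_monic x) (prod_X_sub_C_natDegree x)
  have hf₀ : ((pairPoly₀ k d₀ d₁).map (pairToTriple k d₀ d₁ r).toRingHom).map θ.toRingHom =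
      rootMultiple d₀ x c₀ := by
    have := rootMultiple_monic_natDegree (Nat.sub_add_cancel hr) x c₀
    rw [pairPoly₀, monicPoly_map, monicPoly_map]
    simp only [AlgHom.toRingHom_eq_coe, RingHom.coe_coe, hX, hθ₀]
    exact monicPoly_eq_of_monic this.1 this.2
  have hf₁ : ((pairPoly₁ k d₀ d₁).map (pairToTriple k d₀ d₁ r).toRingHom).map θ.toRingHom =
      monicPoly d₁ c₁ := by
    rw [pairPoly₁, monicPoly_map, monicPoly_map]
    simp only [AlgHom.toRingHom_eq_coe, RingHom.coe_coe, hX, hθ₁]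
  have hm : (triplePoly k d₀ d₁ r).Monic := monicPoly_monic _ _
  have hle₀ : leIdeal (triplePoly k d₀ d₁ r)
      ((pairPoly₀ k d₀ d₁).map (pairToTriple k d₀ d₁ r).toRingHom) ≤ RingHom.ker θ.toRingHom := by
    rw [leIdeal_le_ker_iff _ hm, hh, hf₀]
    exact dvd_rootMultiple _ _ _
  obtain ⟨y, hy, w, hw, rfl⟩ := Submodule.mem_sup.1 hz
  have hy' : θ y = 0 := hle₀ hy
  rw [map_add, hy', zero_add]
  clear hy hz
  induction hw using Submodule.span_induction with
  | mem w hw =>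
    obtain ⟨j, rfl⟩ := hw
    have := det_vandermonde_mul_coeff_eq_zero x hx j
    rwa [← hh, ← hf₁, ← map_modByMonic _ hm, coeff_map] at this
  | zero => rw [map_zero, mul_zero]
  | add w w' _ _ h h' => rw [map_add, mul_add, h, h', add_zero]
  | smul a w _ h => rw [smul_eq_mul, map_mul, mul_left_comm, h, mul_zero]

end Specialization

/-! ### Functionals on the ring of triples -/

section Functional

/-- Reduction of a coordinate with respect to the basis of monomials in roots `x i` of a monic
polynomial of degree `d`, along a homomorphism that turns this polynomial into `X ^ d`. -/
theorem map_repr_aeval {B E C : Type*} [CommRing B] [CommRing E] [Algebra B E] [CommRing C]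
    {r d : ℕ} {x : Fin r → E} (b : Module.Basis (Fin r → Fin d) B E)
    (hb : ∀ e, b e = ∏ i, x i ^ (e i : ℕ)) {c : Fin d → B}
    (hx : ∀ i, aeval (x i) (monicPoly d c) = 0) (ε : B →+* C) (hε : ∀ j, ε (c j) = 0)
    (P : MvPolynomial (Fin r) B) (e : Fin r → Fin d) :
    ε (b.repr (MvPolynomial.aeval x P) e) =
      (P.map ε).coeff (Finsupp.equivFunOnFinite.symm fun i => (e i : ℕ)) := by
  induction P using MvPolynomial.induction_on' with
  | add p q hp hq => simp [hp, hq]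
  | monomial s a =>
    rw [MvPolynomial.aeval_monomial, ← Algebra.smul_def, map_smul, Finsupp.smul_apply, smul_eq_mul,
      map_mul, MvPolynomial.map_monomial, MvPolynomial.coeff_monomial,
      Finsupp.prod_fintype _ _ fun i => pow_zero _]
    by_cases hs : ∀ i, s i < d
    · have h1 : ∏ i, x i ^ s i = b fun i => ⟨s i, hs i⟩ := (hb fun i => ⟨s i, hs i⟩).symm
      rw [h1, Module.Basis.repr_self, Finsupp.single_apply]
      have h2 : (s = Finsupp.equivFunOnFinite.symm fun i => (e i : ℕ)) ↔
          (fun i => (⟨s i, hs i⟩ : Fin d)) = e := by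
        simp [Finsupp.ext_iff, funext_iff, Fin.ext_iff]
      simp only [h2]
      split_ifs <;> simp
    · push Not at hs
      obtain ⟨i, hi⟩ := hs
      rw [if_neg (by
        rintro rfl
        have := (e i).2
        simp only [Finsupp.coe_equivFunOnFinite_symm] at hi
        omega)]
      have h1 : ∏ i, x i ^ s i ∈ (RingHom.ker ε • ⊤ : Submodule B E) := by
        rw [Ideal.smul_top_eq_map]
        change _ ∈ (RingHom.ker ε).map (algebraMap B E)
        refine Ideal.mem_of_dvd _ (Finset.dvd_prod_of_mem _ (Finset.mem_univ i)) ?_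
        refine Ideal.mem_of_dvd _ (pow_dvd_pow _ hi) ?_
        refine pow_mem_of_eval_monicPoly_eq_zero (c := fun j => algebraMap B E (c j)) _
          (fun j => Ideal.mem_map_of_mem _ (hε j)) ?_
        rw [← monicPoly_map, eval_map_algebraMap, hx]
      have h2 := (mem_smul_top_iff_repr b _).1 h1 e
      rw [RingHom.mem_ker] at h2
      rw [h2, mul_zero]

universe u

/-- The functionals on triples of divisors that detect the ring of `Int_r(d₀, d₁)`: a coordinate
of the product with a Vandermonde determinant, in the algebra of `r` independent roots of the
equation of `D₁`. -/
theorem exists_functional (k : Type u) [CommRing k] [Nontrivial k] {d₀ d₁ r : ℕ} (h₀ : r ≤ d₀)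
    (h₁ : r ≤ d₁) (e : Fin r → Fin d₁) :
    ∃ Ψ : DivTripleRing k d₀ d₁ r →+ CoeffRing k d₀ d₁ r,
      (∀ b p, Ψ (pairToTriple k d₀ d₁ r (coeffToPair k d₀ d₁ r b) * p) = b * Ψ p) ∧
      (∀ p ∈ subIdeal k d₀ d₁ r, Ψ p = 0) ∧
      ∀ (C : Type u) [CommRing C] (ε : CoeffRing k d₀ d₁ r →+* C),
        (∀ j, ε (MvPowerSeries.X (Sum.inr j)) = 0) → ∀ α : Fin r → ℕ,
        ε (Ψ (∏ t : Fin r,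
          MvPowerSeries.X (Sum.inr (Sum.inl ⟨d₀ - r + (t : ℕ), by omega⟩)) ^ α t)) =
        (alternant d₀ MvPolynomial.X (fun i : Fin (d₀ - r) =>
            MvPolynomial.C (ε (MvPowerSeries.X (Sum.inl i)))) α).coeff
          (Finsupp.equivFunOnFinite.symm fun i => (e i : ℕ)) := by
  set f : (CoeffRing k d₀ d₁ r)[X] := monicPoly d₁ fun j => MvPowerSeries.X (Sum.inr j) with hf
  have hfd : f.natDegree = d₁ := monicPoly_natDegree _
  obtain ⟨E, _, _, x, b', hb', hx⟩ := exists_algebra_roots (f := f) (monicPoly_monic _ _) r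
    (hfd.symm ▸ h₁)
  obtain ⟨b, hb⟩ : ∃ b : Module.Basis (Fin r → Fin d₁) (CoeffRing k d₀ d₁ r) E,
      ∀ e, b e = ∏ i, x i ^ (e i : ℕ) :=
    ⟨b'.reindex ((Equiv.refl _).arrowCongr (finCongr hfd)), fun e => by
      rw [Module.Basis.reindex_apply, hb']
      rfl⟩
  clear hb' b' hfd
  have : Nontrivial E := ⟨b e, 0, b.ne_zero _⟩
  let _ : Algebra k E :=
    ((algebraMap (CoeffRing k d₀ d₁ r) E).comp (algebraMap k (CoeffRing k d₀ d₁ r))).toAlgebra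
  set Y : Ideal (CoeffRing k d₀ d₁ r) := Ideal.span (Set.range MvPowerSeries.X) with hY
  set J := Y.map (algebraMap (CoeffRing k d₀ d₁ r) E) with hJ
  have : IsAdicComplete Y E := isAdicComplete_of_basis b Y
  have : IsAdicComplete J E := (IsAdicComplete.map_algebraMap_iff Y E).2 this
  have hX (v) : algebraMap (CoeffRing k d₀ d₁ r) E (MvPowerSeries.X v) ∈ J :=
    Ideal.mem_map_of_mem _ (Ideal.subset_span ⟨v, rfl⟩)
  have hx' (i : Fin r) : (monicPoly d₁ fun j => algebraMap (CoeffRing k d₀ d₁ r) E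
      (MvPowerSeries.X (Sum.inr j))).eval (x i) = 0 := by
    rw [← monicPoly_map, eval_map_algebraMap, hx]
  -- the roots are nilpotent modulo `J`, because `f` reduces to `X ^ d₁`
  obtain ⟨θ, hθ, hθ₀, hθ₁⟩ := exists_triple_algHom (k := k) J h₀ (x := x)
    (fun i => ⟨d₁, pow_mem_of_eval_monicPoly_eq_zero J (fun j => hX _) (hx' i)⟩)
    (fun i : Fin (d₀ - r) => hX (Sum.inl i)) (fun j : Fin d₁ => hX (Sum.inr j))
  have hθB (p : CoeffRing k d₀ d₁ r) :
      θ (pairToTriple k d₀ d₁ r (coeffToPair k d₀ d₁ r p)) = algebraMap _ E p := by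
    let ι : CoeffRing k d₀ d₁ r →ₐ[k] E := ⟨algebraMap _ E, fun _ => rfl⟩
    have hv (v : Fin (d₀ - r) ⊕ Fin d₁) :
        θ (pairToTriple k d₀ d₁ r (coeffToPair k d₀ d₁ r (MvPowerSeries.X v))) =
          algebraMap (CoeffRing k d₀ d₁ r) E (MvPowerSeries.X v) := by
      rw [show coeffToPair k d₀ d₁ r (MvPowerSeries.X v) =
          MvPowerSeries.X (Sum.map (Fin.castLE (Nat.sub_le d₀ r)) id v) from
          MvPowerSeries.rename_X _ _,
        show ∀ w, pairToTriple k d₀ d₁ r (MvPowerSeries.X w) = MvPowerSeries.X (Sum.inr w) from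
          fun w => MvPowerSeries.rename_X _ _]
      rcases v with i | j
      · exact (hθ₀ _).trans (rootMultiple_coeff_eq (Nat.sub_add_cancel h₀) _ _ i)
      · exact hθ₁ j
    exact DFunLike.congr_fun (algHom_eq_of_X_eq J
      (θ := θ.comp ((pairToTriple k d₀ d₁ r).comp (coeffToPair k d₀ d₁ r))) (θ' := ι) hv
      fun v => Ideal.le_radical ((hv v).symm ▸ hX v)) p
  refine ⟨((b.coord e).toAddMonoidHom.comp
    (AddMonoidHom.mulLeft (Matrix.vandermonde x).det)).comp (θ : _ →+ E), ?_, ?_, ?_⟩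
  · intro a p
    change b.repr ((Matrix.vandermonde x).det * θ _) e =
      a * b.repr ((Matrix.vandermonde x).det * θ p) e
    rw [map_mul θ, hθB, mul_left_comm, ← Algebra.smul_def, map_smul, Finsupp.smul_apply,
      smul_eq_mul]
  · intro p hp
    change b.repr ((Matrix.vandermonde x).det * θ p) e = 0
    rw [det_vandermonde_mul_eq_zero h₀ hθ hθ₀ hθ₁ hx' hp, map_zero, Finsupp.zero_apply]
  · intro C _ ε hε α
    change ε (b.repr ((Matrix.vandermonde x).det * θ _) e) = _
    have h2 : (Matrix.vandermonde x).det * θ (∏ t : Fin r,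
          MvPowerSeries.X (Sum.inr (Sum.inl ⟨d₀ - r + (t : ℕ), by omega⟩)) ^ α t) =
        MvPolynomial.aeval x (alternant d₀ MvPolynomial.X (fun i : Fin (d₀ - r) =>
          (MvPolynomial.C (MvPowerSeries.X (Sum.inl i)) :
            MvPolynomial (Fin r) (CoeffRing k d₀ d₁ r))) α) := by
      have h3 := map_alternant (MvPolynomial.aeval x).toRingHom d₀ MvPolynomial.X
        (fun i : Fin (d₀ - r) => (MvPolynomial.C (MvPowerSeries.X (Sum.inl i)) :
            MvPolynomial (Fin r) (CoeffRing k d₀ d₁ r))) α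
      refine Eq.trans ?_ h3.symm
      rw [alternant, map_prod]
      congr 1
      · simp
      · refine Finset.prod_congr rfl fun t _ => ?_
        rw [map_pow, hθ₀]
        have := t.2
        rw [show d₀ - 1 - (d₀ - r + (t : ℕ)) = r - 1 - t by omega]
        simp
    rw [h2, map_repr_aeval b hb hx ε hε]
    congr 1
    refine (map_alternant (MvPolynomial.map ε) d₀ _ _ α).trans ?_
    simp

end Functional

/-! ### Monomials of highest weight -/

section LeadingMonomials

variable {σ A : Type*} [CommRing A] (ρ : (σ →₀ ℕ) →+ ℤ)

/-- All monomials of `p` have weight at most `a`. -/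
def WeightLE (p : MvPolynomial σ A) (a : ℤ) : Prop :=
  ∀ e, p.coeff e ≠ 0 → ρ e ≤ a

/-- The monomial with exponent `e` is the only monomial of highest weight that may occur in `p`,
and its coefficient is associated to `u`; neither is required to be nonzero. -/
def HasLead (p : MvPolynomial σ A) (e : σ →₀ ℕ) (u : A) : Prop :=
  Associated (p.coeff e) u ∧ ∀ e', e' ≠ e → p.coeff e' ≠ 0 → ρ e' < ρ e

variable {ρ} {p q : MvPolynomial σ A} {a b : ℤ}

theorem WeightLE.mono (hp : WeightLE ρ p a) (h : a ≤ b) : WeightLE ρ p b :=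
  fun e he => (hp e he).trans h

theorem WeightLE.sub (hp : WeightLE ρ p a) (hq : WeightLE ρ q a) : WeightLE ρ (p - q) a := by
  intro e he
  by_cases h : p.coeff e = 0
  · refine hq e fun h' => he ?_
    rw [MvPolynomial.coeff_sub, h, h', sub_zero]
  · exact hp e h

theorem weightLE_zero : WeightLE ρ (0 : MvPolynomial σ A) a :=
  fun e he => absurd (MvPolynomial.coeff_zero e) he

theorem weightLE_one : WeightLE ρ (1 : MvPolynomial σ A) 0 := by
  classical
  intro e he
  rw [MvPolynomial.coeff_one] at he
  split_ifs at he with h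
  · rw [← h, map_zero]
  · exact absurd rfl he

theorem WeightLE.mul (hp : WeightLE ρ p a) (hq : WeightLE ρ q b) : WeightLE ρ (p * q) (a + b) := by
  classical
  intro e he
  rw [MvPolynomial.coeff_mul] at he
  obtain ⟨⟨f, g⟩, hfg, h⟩ := Finset.exists_ne_zero_of_sum_ne_zero he
  rw [Finset.HasAntidiagonal.mem_antidiagonal] at hfg
  rw [← hfg, map_add]
  exact add_le_add (hp f (left_ne_zero_of_mul h)) (hq g (right_ne_zero_of_mul h))

theorem HasLead.one : HasLead ρ (1 : MvPolynomial σ A) 0 1 := by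
  classical
  refine ⟨by rw [MvPolynomial.coeff_zero_one], fun e he h => absurd ?_ h⟩
  rw [MvPolynomial.coeff_one, if_neg he.symm]

theorem HasLead.mul {e f : σ →₀ ℕ} {u v : A} (hp : HasLead ρ p e u) (hq : HasLead ρ q f v) :
    HasLead ρ (p * q) (e + f) (u * v) := by
  classical
  -- a pair of monomials of `p` and `q` other than the leading ones has a product of lower weight
  have key {e' f' : σ →₀ ℕ} (h : p.coeff e' * q.coeff f' ≠ 0) (hne : (e', f') ≠ (e, f)) :
      ρ (e' + f') < ρ (e + f) := by
    have h1 := left_ne_zero_of_mul h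
    have h2 := right_ne_zero_of_mul h
    rw [map_add, map_add]
    by_cases h3 : e' = e
    · subst h3
      have h4 := hq.2 f' (fun h4 => hne (by rw [h4])) h2
      omega
    · have h4 := hp.2 e' h3 h1
      by_cases h5 : f' = f
      · subst h5; omega
      · have := hq.2 f' h5 h2
        omega
  constructor
  · rw [MvPolynomial.coeff_mul, Finset.sum_eq_single (e, f)]
    · exact hp.1.mul_mul hq.1
    · rintro ⟨e', f'⟩ h hne
      by_contra h'
      have := key h' hne
      rw [Finset.HasAntidiagonal.mem_antidiagonal] at h
      rw [← h] at this
      exact lt_irrefl _ this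
    · intro h
      exact absurd (by rw [Finset.HasAntidiagonal.mem_antidiagonal]) h
  · intro g hg h
    rw [MvPolynomial.coeff_mul] at h
    obtain ⟨⟨e', f'⟩, hef, h⟩ := Finset.exists_ne_zero_of_sum_ne_zero h
    rw [Finset.HasAntidiagonal.mem_antidiagonal] at hef
    simp only [] at hef
    rw [← hef]
    refine key h fun h' => hg ?_
    obtain ⟨rfl, rfl⟩ := Prod.ext_iff.1 h'
    exact hef.symm

theorem HasLead.prod {ι : Type*} (s : Finset ι) {p : ι → MvPolynomial σ A} {e : ι → σ →₀ ℕ}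
    {u : ι → A} (h : ∀ i ∈ s, HasLead ρ (p i) (e i) (u i)) :
    HasLead ρ (∏ i ∈ s, p i) (∑ i ∈ s, e i) (∏ i ∈ s, u i) := by
  classical
  induction s using Finset.induction_on with
  | empty => simpa using HasLead.one
  | insert i s hi ih =>
    rw [Finset.prod_insert hi, Finset.sum_insert hi, Finset.prod_insert hi]
    exact (h i (Finset.mem_insert_self _ _)).mul
      (ih fun j hj => h j (Finset.mem_insert_of_mem hj))

theorem HasLead.pow {e : σ →₀ ℕ} {u : A} (hp : HasLead ρ p e u) (n : ℕ) :
    HasLead ρ (p ^ n) (n • e) (u ^ n) := by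
  simpa using HasLead.prod (Finset.range n) fun _ _ => hp

theorem HasLead.C_mul {e : σ →₀ ℕ} {u : A} (hp : HasLead ρ p e u) (c : A) :
    HasLead ρ (MvPolynomial.C c * p) e (c * u) := by
  refine ⟨?_, fun e' he h => hp.2 e' he fun h' => h ?_⟩
  · rw [MvPolynomial.coeff_C_mul]
    exact hp.1.mul_left c
  · rw [MvPolynomial.coeff_C_mul, h', mul_zero]

theorem HasLead.sub_weightLE {e : σ →₀ ℕ} {u : A} (hp : HasLead ρ p e u) (hq : WeightLE ρ q a)
    (ha : a < ρ e) : HasLead ρ (p - q) e u := by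
  have hq' (e') (h : ρ e ≤ ρ e') : q.coeff e' = 0 := by
    by_contra h'
    have := hq e' h'
    omega
  refine ⟨?_, fun e' he h => ?_⟩
  · rw [MvPolynomial.coeff_sub, hq' e le_rfl, sub_zero]
    exact hp.1
  · by_contra h'
    refine h' (hp.2 e' he fun h2 => h ?_)
    rw [MvPolynomial.coeff_sub, h2, hq' e' (not_lt.1 h'), sub_zero]

end LeadingMonomials

/-! ### Determinants of triangular matrices -/

section Triangular

/-- A matrix that is triangular for a strict partial order given by an integer valued weight. -/
theorem det_eq_prod_of_weight_lt {ι A : Type*} [Fintype ι] [DecidableEq ι] [CommRing A]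
    {M : Matrix ι ι A} (w : ι → ℤ) (h : ∀ i j, j ≠ i → M i j ≠ 0 → w j < w i) :
    M.det = ∏ i, M i i := by
  rw [Matrix.det_apply, Finset.sum_eq_single 1]
  · simp
  · intro g _ hg
    have : ∃ i, M (g i) i = 0 := by
      by_contra! hne
      have hle (i : ι) : w i ≤ w (g i) := by
        by_cases hi : i = g i
        · rw [← hi]
        · exact (h _ _ hi (hne i)).le
      obtain ⟨i, hi⟩ : ∃ i, g i ≠ i := by
        by_contra! h'
        exact hg (Equiv.ext h')
      have := Finset.sum_lt_sum (fun i _ => hle i) ⟨i, Finset.mem_univ i, h _ _ hi.symm (hne i)⟩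
      rw [Equiv.sum_comp g w] at this
      exact lt_irrefl _ this
    obtain ⟨i, hi⟩ := this
    have hprod : ∏ i, M (g i) i = 0 := Finset.prod_eq_zero (Finset.mem_univ i) hi
    rw [hprod, smul_zero]
  · intro h'
    exact absurd (Finset.mem_univ _) h'

end Triangular

/-! ### Leading monomials of alternants -/

section Weights

variable {A : Type*} [CommRing A] {r : ℕ}

/-- The weight for which the variable `x i` weighs `-(r ^ 2 + i)`. It puts monomials of low degree
first, and monomials in early variables first among those of the same degree. -/
noncomputable def rootWeight (r : ℕ) : (Fin r →₀ ℕ) →+ ℤ :=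
  (Finsupp.weight fun i : Fin r => -((r : ℤ) ^ 2 + (i : ℕ)))

theorem rootWeight_single (i : Fin r) :
    rootWeight r (Finsupp.single i 1) = -((r : ℤ) ^ 2 + (i : ℕ)) := by
  rw [rootWeight, Finsupp.weight_single, one_smul]

theorem hasLead_X_sub_X {i j : Fin r} (h : i < j) :
    HasLead (rootWeight r) (MvPolynomial.X j - MvPolynomial.X i : MvPolynomial (Fin r) A)
      (Finsupp.single i 1) 1 := by
  classical
  have hij : Finsupp.single j 1 ≠ (Finsupp.single i 1 : Fin r →₀ ℕ) := fun h' =>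
    h.ne' (Finsupp.single_left_injective one_ne_zero h')
  refine ⟨?_, fun e he h' => ?_⟩
  · rw [MvPolynomial.coeff_sub, MvPolynomial.coeff_X, MvPolynomial.coeff_X, if_neg hij,
      if_pos rfl, zero_sub]
    exact (Associated.refl (1 : A)).neg_left
  · rw [MvPolynomial.coeff_sub, MvPolynomial.coeff_X, MvPolynomial.coeff_X, if_neg he.symm,
      sub_zero] at h'
    split_ifs at h' with h2
    · rw [← h2, rootWeight_single, rootWeight_single]
      have : (i : ℕ) < j := h
      omega
    · exact absurd rfl h'

theorem hasLead_det_vandermonde :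
    HasLead (rootWeight r) (Matrix.vandermonde (MvPolynomial.X : _ → MvPolynomial (Fin r) A)).det
      (∑ i : Fin r, (r - 1 - (i : ℕ)) • Finsupp.single i 1) 1 := by
  rw [Matrix.det_vandermonde]
  have := HasLead.prod (ρ := rootWeight r) (A := A) Finset.univ fun (i : Fin r) _ =>
    HasLead.prod (Finset.Ioi i) fun j hj => hasLead_X_sub_X (Finset.mem_Ioi.1 hj)
  simpa using this

/-- The elementary symmetric polynomial of degree `t + 1` leads with `x 0 * ... * x t`. -/
theorem hasLead_esymm (t : Fin r) :
    HasLead (rootWeight r) (MvPolynomial.esymm (Fin r) A (t + 1))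
      (∑ i ∈ Finset.Iic t, Finsupp.single i 1) 1 := by
  classical
  have hcard : (Finset.Iic t).card = t + 1 := Fin.card_Iic t
  have hinj {S S' : Finset (Fin r)}
      (h : ∑ i ∈ S, Finsupp.single i 1 = (∑ i ∈ S', Finsupp.single i 1 : Fin r →₀ ℕ)) :
      S = S' := by
    ext i
    have := DFunLike.congr_fun h i
    simp only [Finsupp.finsetSum_apply, Finsupp.single_apply, Finset.sum_ite_eq'] at this
    split_ifs at this with h1 h2 h2 <;> simp_all
  rw [MvPolynomial.esymm_eq_sum_monomial]
  refine ⟨?_, fun e he h => ?_⟩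
  · rw [MvPolynomial.coeff_sum, Finset.sum_eq_single (Finset.Iic t)]
    · rw [MvPolynomial.coeff_monomial, if_pos rfl]
    · intro S _ hS
      rw [MvPolynomial.coeff_monomial, if_neg fun h => hS (hinj h)]
    · intro h
      exact absurd (Finset.mem_powersetCard_univ.2 hcard) h
  · rw [MvPolynomial.coeff_sum] at h
    obtain ⟨S, hS, h⟩ := Finset.exists_ne_zero_of_sum_ne_zero h
    rw [MvPolynomial.coeff_monomial] at h
    split_ifs at h with h'
    · subst h'
      have hSt : S ≠ Finset.Iic t := fun h => he (by rw [h])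
      rw [Finset.mem_powersetCard_univ] at hS
      simp only [map_sum, rootWeight_single]
      rw [← Finset.sum_sdiff_lt_sum_sdiff]
      have hc : (S \ Finset.Iic t).card = (Finset.Iic t \ S).card :=
        Finset.card_sdiff_comm (hS.trans hcard.symm)
      have hpos : 0 < (S \ Finset.Iic t).card := by
        rw [Finset.card_pos, Finset.sdiff_nonempty]
        intro hle
        exact hSt (Finset.eq_of_subset_of_card_le hle (by omega))
      have h1 := Finset.sum_le_card_nsmul (S \ Finset.Iic t)
        (fun i => -((r : ℤ) ^ 2 + (i : ℕ))) (-((r : ℤ) ^ 2 + (t + 1 : ℕ))) fun i hi => by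
          have : t < i := by simpa using (Finset.mem_sdiff.1 hi).2
          have : (t : ℕ) < i := this
          omega
      have h2 := Finset.card_nsmul_le_sum (Finset.Iic t \ S)
        (fun i => -((r : ℤ) ^ 2 + (i : ℕ))) (-((r : ℤ) ^ 2 + (t : ℕ))) fun i hi => by
          have : i ≤ t := by simpa using (Finset.mem_sdiff.1 hi).1
          have : (i : ℕ) ≤ t := this
          omega
      refine h1.trans_lt (lt_of_lt_of_le ?_ h2)
      rw [hc] at hpos ⊢
      rw [nsmul_eq_mul, nsmul_eq_mul]
      refine mul_lt_mul_of_pos_left ?_ (by exact_mod_cast hpos)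
      push_cast
      omega
    · exact absurd rfl h

theorem weightLE_X (i : Fin r) :
    WeightLE (rootWeight r) (MvPolynomial.X i : MvPolynomial (Fin r) A) (-(r : ℤ) ^ 2) := by
  classical
  intro e he
  rw [MvPolynomial.coeff_X] at he
  split_ifs at he with h
  · rw [← h, rootWeight_single]
    omega
  · exact absurd rfl he

theorem HasLead.congr {σ : Type*} {ρ : (σ →₀ ℕ) →+ ℤ} {p : MvPolynomial σ A} {e : σ →₀ ℕ}
    {u v : A} (hp : HasLead ρ p e u) (h : Associated u v) : HasLead ρ p e v :=
  ⟨hp.1.trans h, hp.2⟩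

theorem weightLE_prod_coeff (s : Finset (Fin r)) (j : ℕ) :
    WeightLE (rootWeight r)
      ((∏ i ∈ s, (X - C (MvPolynomial.X i : MvPolynomial (Fin r) A))).coeff j)
      (-(r : ℤ) ^ 2 * (s.card - j)) := by
  classical
  induction s using Finset.induction_on generalizing j with
  | empty =>
    rw [Finset.prod_empty, coeff_one]
    split_ifs with h
    · subst h
      simpa using weightLE_one
    · exact weightLE_zero
  | insert i s hi ih =>
    rw [Finset.prod_insert hi, sub_mul, coeff_sub, coeff_C_mul, Finset.card_insert_of_notMem hi]
    refine WeightLE.sub ?_ (((weightLE_X i).mul (ih j)).mono (le_of_eq (by push_cast; ring)))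
    cases j with
    | zero => simpa using weightLE_zero
    | succ j =>
      rw [coeff_X_mul]
      exact (ih j).mono (le_of_eq (by push_cast; ring))

/-- The recursion for remainders of powers of `X`. -/
theorem X_pow_succ_modByMonic {h : A[X]} (hh : h.Monic) (hd : h.natDegree = r + 1) (d : ℕ) :
    (X ^ (d + 1) : A[X]) %ₘ h = X * (X ^ d %ₘ h) - C ((X ^ d %ₘ h).coeff r) * h := by
  rcases subsingleton_or_nontrivial A with hA | hA
  · exact Subsingleton.elim _ _
  have hdeg : h.degree = (r + 1 : ℕ) := by rw [degree_eq_natDegree hh.ne_zero, hd]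
  have hR (j : ℕ) (hj : r + 1 ≤ j) : (X ^ d %ₘ h).coeff j = 0 :=
    coeff_eq_zero_of_degree_lt ((degree_modByMonic_lt _ hh).trans_le
      (by rw [hdeg]; exact_mod_cast hj))
  refine (div_modByMonic_unique (X * (X ^ d /ₘ h) + C ((X ^ d %ₘ h).coeff r)) _ hh
    ⟨?_, ?_⟩).2
  · have := modByMonic_add_div (X ^ d) h
    rw [pow_succ']
    linear_combination X * this
  · rw [hdeg, degree_lt_iff_coeff_zero]
    intro j hj
    obtain ⟨j, rfl⟩ := Nat.exists_eq_add_of_le' (Nat.le_of_add_left_le hj : 1 ≤ j)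
    rw [coeff_sub, coeff_X_mul, coeff_C_mul]
    rcases eq_or_lt_of_le (Nat.le_of_succ_le_succ hj) with rfl | hj'
    · have := hh.coeff_natDegree
      rw [hd] at this
      rw [this, mul_one, sub_self]
    · rw [hR j hj', coeff_eq_zero_of_natDegree_lt (p := h) (by omega), mul_zero, sub_zero]

/-- The coefficients of the remainder of `X ^ d` on division by the generic polynomial of degree
`r` have the weight that homogeneity dictates. -/
theorem weightLE_X_pow_modByMonic_coeff [Nontrivial A] (d j : ℕ) :
    WeightLE (rootWeight r)
      ((X ^ d %ₘ ∏ i, (X - C (MvPolynomial.X i : MvPolynomial (Fin r) A))).coeff j)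
      (-(r : ℤ) ^ 2 * (d - j)) := by
  rcases r with _ | r
  · simpa using weightLE_zero
  have hd := prod_X_sub_C_natDegree (MvPolynomial.X : _ → MvPolynomial (Fin (r + 1)) A)
  have hh := prod_X_sub_C_monic (MvPolynomial.X : _ → MvPolynomial (Fin (r + 1)) A)
  induction d generalizing j with
  | zero =>
    rw [pow_zero, (modByMonic_eq_self_iff hh).2 (by
      rw [degree_one, degree_eq_natDegree hh.ne_zero, hd]
      exact_mod_cast Nat.succ_pos r), coeff_one]
    split_ifs with h
    · subst h
      simpa using weightLE_one
    · exact weightLE_zero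
  | succ d ih =>
    rw [X_pow_succ_modByMonic hh hd, coeff_sub, coeff_C_mul]
    have h1 := weightLE_prod_coeff (A := A) (Finset.univ : Finset (Fin (r + 1))) j
    rw [Finset.card_univ, Fintype.card_fin] at h1
    refine WeightLE.sub ?_ (((ih r).mul h1).mono (le_of_eq (by push_cast; ring)))
    cases j with
    | zero => simpa using weightLE_zero
    | succ j =>
      rw [coeff_X_mul]
      exact (ih j).mono (le_of_eq (by push_cast; ring))

theorem hasLead_prod_coeff (t : Fin r) :
    HasLead (rootWeight r)
      ((∏ i, (X - C (MvPolynomial.X i : MvPolynomial (Fin r) A))).coeff (r - 1 - t))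
      (∑ i ∈ Finset.Iic t, Finsupp.single i 1) 1 := by
  have ht := t.2
  have h : (∏ i, (X - C (MvPolynomial.X i : MvPolynomial (Fin r) A))).coeff (r - 1 - t) =
      MvPolynomial.C ((-1) ^ (t + 1 : ℕ)) * MvPolynomial.esymm (Fin r) A (t + 1) := by
    have := Multiset.prod_X_sub_C_coeff
      (Finset.univ.val.map (MvPolynomial.X : _ → MvPolynomial (Fin r) A)) (k := r - 1 - t)
      (by simp; omega)
    rw [Multiset.map_map, ← MvPolynomial.esymm_eq_multiset_esymm] at this
    refine this.trans ?_
    simp only [Multiset.card_map, Finset.card_val, Finset.card_univ, Fintype.card_fin, map_pow,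
      map_neg, map_one]
    rw [show r - (r - 1 - (t : ℕ)) = t + 1 by omega]
  rw [h]
  refine ((hasLead_esymm t).C_mul _).congr ?_
  rw [mul_one, associated_one_iff_isUnit]
  exact (isUnit_one.neg).pow _

theorem rootMultiple_self (x : Fin r → A) (c : Fin 0 → A) :
    rootMultiple r x c = ∏ i, (X - C (x i)) := by
  rcases subsingleton_or_nontrivial A with hA | hA
  · exact Subsingleton.elim _ _
  have hh := prod_X_sub_C_monic x
  have hlt : (X ^ r - ∏ i, (X - C (x i)) : A[X]).degree < (∏ i, (X - C (x i))).degree := by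
    rw [← neg_sub, degree_neg]
    refine degree_sub_lt_left ?_ hh.ne_zero (by rw [hh, (monic_X_pow r).leadingCoeff])
    rw [degree_eq_natDegree hh.ne_zero, prod_X_sub_C_natDegree, degree_X_pow]
  have := (div_modByMonic_unique 1 (X ^ r - ∏ i, (X - C (x i))) hh
    ⟨by rw [mul_one, sub_add_cancel], hlt⟩).2
  rw [rootMultiple, Finset.univ_eq_empty, Finset.sum_empty, add_zero, this, sub_sub_cancel]

/-- When only the last given coefficient is nonzero, `rootMultiple` is that coefficient times `∏
i, (X - x i)`, up to terms that do not involve it. -/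
theorem rootMultiple_eq_of_eq_zero {n d : ℕ} (h : n + 1 + r = d) (x : Fin r → A)
    (c : Fin (n + 1) → A) (hc : ∀ i : Fin n, c i.castSucc = 0) :
    rootMultiple d x c = C (c (Fin.last n)) * ∏ i, (X - C (x i)) +
      (X ^ d - X ^ d %ₘ ∏ i, (X - C (x i))) := by
  have h1 := rootMultiple_self x Fin.elim0
  rw [rootMultiple, Finset.univ_eq_empty, Finset.sum_empty, add_zero] at h1
  rw [rootMultiple, Fin.sum_univ_castSucc]
  simp only [hc, map_zero, zero_mul, Finset.sum_const_zero, zero_add, Fin.val_last]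
  rw [show d - 1 - n = r by omega, ← smul_eq_C_mul, add_modByMonic, smul_modByMonic,
    ← smul_eq_C_mul]
  nth_rewrite 3 [← h1]
  rw [smul_sub]
  ring

/-- The lower coefficients of `rootMultiple` lead with the monomials `x 0 * ... * x t` of the
elementary symmetric polynomials, the other terms having higher degree in the roots. -/
theorem hasLead_rootMultiple_coeff [Nontrivial A] {n d : ℕ} (h : n + 1 + r = d)
    (c : Fin (n + 1) → A) (hc : ∀ i : Fin n, c i.castSucc = 0) (t : Fin r) :
    HasLead (rootWeight r)
      ((rootMultiple d (MvPolynomial.X : _ → MvPolynomial (Fin r) A)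
        fun i => MvPolynomial.C (c i)).coeff (r - 1 - t))
      (∑ i ∈ Finset.Iic t, Finsupp.single i 1) (c (Fin.last n)) := by
  have ht := t.2
  rw [rootMultiple_eq_of_eq_zero h _ _ fun i => by rw [hc, map_zero], coeff_add, coeff_C_mul,
    coeff_sub, coeff_X_pow, if_neg (by omega), zero_sub, ← sub_eq_add_neg]
  refine (((hasLead_prod_coeff t).C_mul (c (Fin.last n))).sub_weightLE
    (weightLE_X_pow_modByMonic_coeff d (r - 1 - t)) ?_).congr (by rw [mul_one])
  simp only [map_sum, rootWeight_single]
  have h1 := Finset.card_nsmul_le_sum (Finset.Iic t) (fun i : Fin r => -((r : ℤ) ^ 2 + (i : ℕ)))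
    (-((r : ℤ) ^ 2 + (t : ℕ))) fun i hi => by
      have : i ≤ t := Finset.mem_Iic.1 hi
      have : (i : ℕ) ≤ t := this
      omega
  refine lt_of_lt_of_le ?_ h1
  rw [Fin.card_Iic, nsmul_eq_mul]
  have h2 : ((r - 1 - t : ℕ) : ℤ) = r - 1 - t := by omega
  have h3 : (d : ℤ) = n + 1 + r := by omega
  have h4 : (t : ℤ) + 1 ≤ r := by omega
  rw [h2, h3]
  push_cast
  nlinarith [mul_nonneg (sq_nonneg (r : ℤ)) (Int.natCast_nonneg n), Int.natCast_nonneg (t : ℕ)]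

/-- The exponent of the leading monomial of the alternant with exponents `α`. -/
noncomputable def leadExponent (α : Fin r → ℕ) : Fin r →₀ ℕ :=
  Finsupp.equivFunOnFinite.symm fun i => ∑ t ∈ Finset.Ici i, α t + (r - 1 - i)

theorem leadExponent_injective : Function.Injective (leadExponent (r := r)) := by
  intro α β h
  have h1 (i : Fin r) : ∑ t ∈ Finset.Ici i, α t = ∑ t ∈ Finset.Ici i, β t := by
    have := DFunLike.congr_fun h i
    simpa [leadExponent] using this
  have h2 (i : Fin r) : ∑ t ∈ Finset.Ioi i, α t = ∑ t ∈ Finset.Ioi i, β t := by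
    by_cases hi : (i : ℕ) + 1 < r
    · have : Finset.Ioi i = Finset.Ici ⟨i + 1, hi⟩ := by
        ext j
        rw [Finset.mem_Ioi, Finset.mem_Ici, Fin.lt_def, Fin.le_def]
        exact Nat.lt_iff_add_one_le
      rw [this, h1]
    · have : Finset.Ioi i = ∅ := by
        ext j
        have := j.2
        simp only [Finset.mem_Ioi, Fin.lt_def, Finset.notMem_empty, iff_false]
        omega
      rw [this, Finset.sum_empty, Finset.sum_empty]
  funext i
  have := h1 i
  rw [← Finset.Ioi_insert, Finset.sum_insert (by simp), Finset.sum_insert (by simp), h2] at this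
  exact Nat.add_right_cancel this

theorem hasLead_alternant {n d : ℕ} {c : Fin n → A} {y : A}
    (h : ∀ t : Fin r, HasLead (rootWeight r)
      ((rootMultiple d (MvPolynomial.X : _ → MvPolynomial (Fin r) A)
        fun i => MvPolynomial.C (c i)).coeff (r - 1 - t))
      (∑ i ∈ Finset.Iic t, Finsupp.single i 1) y) (α : Fin r → ℕ) :
    HasLead (rootWeight r) (alternant d MvPolynomial.X (fun i => MvPolynomial.C (c i)) α)
      (leadExponent α) (y ^ ∑ t, α t) := by
  have h1 := (hasLead_det_vandermonde (A := A) (r := r)).mul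
    (HasLead.prod Finset.univ fun t _ => (h t).pow (α t))
  rw [one_mul, Finset.prod_pow_eq_pow_sum] at h1
  have h2 : leadExponent α = ∑ i : Fin r, (r - 1 - (i : ℕ)) • Finsupp.single i 1 +
      ∑ t, α t • ∑ i ∈ Finset.Iic t, Finsupp.single i 1 := ?_
  · rw [h2]
    exact h1
  refine Finsupp.ext fun i => ?_
  simp only [leadExponent, Finsupp.coe_equivFunOnFinite_symm, Finsupp.add_apply,
    Finsupp.finsetSum_apply, Finsupp.smul_apply, Finsupp.single_apply, smul_eq_mul, mul_ite,
    mul_one, mul_zero, Finset.sum_ite_eq', Finset.mem_univ, if_true, Finset.mem_Iic]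
  rw [add_comm, ← Finset.sum_filter, Finset.filter_le_eq_Ici]

/-- The matrix of leading coordinates of the alternants is triangular, with powers of `y` on the
diagonal. -/
theorem associated_det_alternant {n d D : ℕ} {c : Fin n → A} {y : A}
    (h : ∀ t : Fin r, HasLead (rootWeight r)
      ((rootMultiple d (MvPolynomial.X : _ → MvPolynomial (Fin r) A)
        fun i => MvPolynomial.C (c i)).coeff (r - 1 - t))
      (∑ i ∈ Finset.Iic t, Finsupp.single i 1) y)
    [DecidableEq {α : Fin r → ℕ // ∑ t, α t ≤ D}] :
    Associated (Matrix.of fun α β : {α : Fin r → ℕ // ∑ t, α t ≤ D} =>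
      (alternant d MvPolynomial.X (fun i => MvPolynomial.C (c i)) α.1).coeff
        (leadExponent β.1)).det
      (y ^ ∑ α : {α : Fin r → ℕ // ∑ t, α t ≤ D}, ∑ t, α.1 t) := by
  rw [det_eq_prod_of_weight_lt fun α : {α : Fin r → ℕ // ∑ t, α t ≤ D} =>
    rootWeight r (leadExponent α.1)]
  · rw [← Finset.prod_pow_eq_pow_sum]
    exact Associated.prod _ _ _ fun α _ => (hasLead_alternant h α.1).1
  · intro α β hne h0
    exact (hasLead_alternant h α.1).2 _
      (fun h' => hne (Subtype.ext (leadExponent_injective h'))) h0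

end Weights

/-! ### Coordinates on the ring of triples -/

section Determinant

universe u

/-- Multiplication by a power series that specializes to the determinant of the leading coordinates
of alternants whenever all coefficients of the equation of `D₁` vanish has a left inverse that is
linear over the coordinate ring of `Div_{d₁}`. -/
theorem exists_leftInverse_mul_det {k : Type u} [CommRing k] [Nontrivial k] {n d₀ d₁ r D : ℕ}
    (h : n + r = d₀) [DecidableEq {α : Fin r → ℕ // ∑ t, α t ≤ D}]
    (Δ : MvPowerSeries (Fin n ⊕ Fin d₁) k)
    (H : ∀ (C : Type u) [CommRing C] (ε : MvPowerSeries (Fin n ⊕ Fin d₁) k →+* C),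
      (∀ j, ε (MvPowerSeries.X (Sum.inr j)) = 0) →
      ε Δ = (Matrix.of fun α β : {α : Fin r → ℕ // ∑ t, α t ≤ D} =>
        (alternant d₀ MvPolynomial.X
            (fun i : Fin n => MvPolynomial.C (ε (MvPowerSeries.X (Sum.inl i)))) α.1).coeff
          (leadExponent β.1)).det) :
    ∃ S : MvPowerSeries (Fin n ⊕ Fin d₁) k →+ MvPowerSeries (Fin n ⊕ Fin d₁) k,
      (∀ p, S (Δ * p) = p) ∧
      ∀ (v : DivRing k d₁) p, S (MvPowerSeries.rename Sum.inr v * p) =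
        MvPowerSeries.rename Sum.inr v * S p := by
  rcases n with _ | n
  · -- without a lower coefficient `Δ` is invertible
    obtain rfl : r = d₀ := by omega
    have h1 := H k MvPowerSeries.constantCoeff fun j => MvPowerSeries.constantCoeff_X _
    have h2 := associated_det_alternant (n := 0) (d := r) (D := D) (y := (1 : k))
      (c := fun i => MvPowerSeries.constantCoeff (MvPowerSeries.X (Sum.inl i : Fin 0 ⊕ Fin d₁)))
      fun t => by
        rw [rootMultiple_self]
        exact hasLead_prod_coeff t
    rw [← h1, one_pow, associated_one_iff_isUnit, ← MvPowerSeries.isUnit_iff_constantCoeff] at h2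
    obtain ⟨w, rfl⟩ := h2
    refine ⟨AddMonoidHom.mulLeft ((w⁻¹ : _ˣ) : MvPowerSeries (Fin 0 ⊕ Fin d₁) k), fun p => ?_,
      fun v p => ?_⟩
    · simp
    · simp only [AddMonoidHom.coe_mulLeft]
      ring
  · -- all variables but the last lower coefficient may be set to zero
    let i₀ : Fin (n + 1) ⊕ Fin d₁ := Sum.inl (Fin.last n)
    let e : Unit ↪ Fin (n + 1) ⊕ Fin d₁ := ⟨fun _ => i₀, fun _ _ _ => rfl⟩
    let ε := MvPowerSeries.killCompl (R := k) e
    have hε₀ : ε (MvPowerSeries.X i₀) = MvPowerSeries.X () := MvPowerSeries.killCompl_X (e := e) ()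
    have h1 := H (MvPowerSeries Unit k) ε.toRingHom fun j =>
      MvPowerSeries.killCompl_X_eq_zero (by simp [e, i₀])
    have h2 := associated_det_alternant (n := n + 1) (d := d₀) (D := D)
      (y := (MvPowerSeries.X () : MvPowerSeries Unit k))
      (c := fun i => ε.toRingHom (MvPowerSeries.X (Sum.inl i : Fin (n + 1) ⊕ Fin d₁)))
      fun t => by
        have := hasLead_rootMultiple_coeff h
          (fun i => ε.toRingHom (MvPowerSeries.X (Sum.inl i : Fin (n + 1) ⊕ Fin d₁)))
          (fun i => MvPowerSeries.killCompl_X_eq_zero (by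
            rintro ⟨_, hi⟩
            exact (Fin.castSucc_lt_last i).ne' (Sum.inl_injective hi))) t
        exact this.congr (by rw [← hε₀]; exact Associated.refl _)
    rw [← h1] at h2
    obtain ⟨w, hw⟩ := h2.symm
    have hcoeff (j : ℕ) : MvPowerSeries.coeff (Finsupp.single i₀ j) Δ =
        PowerSeries.coeff j (ε Δ : PowerSeries k) := by
      have : Finsupp.single i₀ j = (Finsupp.single () j).embDomain e :=
        (Finsupp.embDomain_single e () j).symm
      rw [this]
      exact (MvPowerSeries.coeff_killCompl Δ (Finsupp.single () j)).symm
    replace hw : (ε Δ : PowerSeries k) = PowerSeries.X ^ _ * (w : PowerSeries k) := hw.symm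
    refine exists_leftInverse_mul i₀ Function.Embedding.inr (by simp [i₀]) Δ
      (∑ α : {α : Fin r → ℕ // ∑ t, α t ≤ D}, ∑ t, α.1 t) (fun j hj => ?_) ?_
    · rw [hcoeff, hw, PowerSeries.coeff_X_pow_mul', if_neg (by omega)]
    · rw [hcoeff, hw, PowerSeries.coeff_X_pow_mul', if_pos le_rfl, Nat.sub_self,
        PowerSeries.coeff_zero_eq_constantCoeff_apply]
      exact w.isUnit.map PowerSeries.constantCoeff

/-- Coordinates on the ring of triples that vanish on the equations of `Sub_r(d₀, d₁)` and read
off the coefficients of a combination of the monomials in the top coefficients. -/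
theorem exists_coordinates (k : Type u) [CommRing k] {d₀ d₁ r : ℕ} (h₀ : r ≤ d₀) (h₁ : r ≤ d₁) :
    ∃ Φ : DivTripleRing k d₀ d₁ r →+ ({α : Fin r → ℕ // ∑ t, α t ≤ d₁ - r} →
        CoeffRing k d₀ d₁ r),
      (∀ p ∈ subIdeal k d₀ d₁ r, Φ p = 0) ∧
      (∀ (v : DivRing k d₁) p α, Φ (pairToTriple k d₀ d₁ r (divToPair k d₀ d₁ v) * p) α =
        MvPowerSeries.rename Sum.inr v * Φ p α) ∧
      ∀ b, Φ (pairToTriple k d₀ d₁ r (∑ α, coeffToPair k d₀ d₁ r (b α) *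
        ∏ t : Fin r, (MvPowerSeries.X (Sum.inl ⟨d₀ - r + (t : ℕ), by omega⟩)) ^ α.1 t)) = b := by
  classical
  rcases subsingleton_or_nontrivial k with hk | hk
  · have : Subsingleton (CoeffRing k d₀ d₁ r) :=
      ⟨fun a b => by ext; exact Subsingleton.elim _ _⟩
    exact ⟨0, fun _ _ => rfl, fun _ _ _ => Subsingleton.elim _ _, fun _ => Subsingleton.elim _ _⟩
  have hlt (β : {α : Fin r → ℕ // ∑ t, α t ≤ d₁ - r}) (i : Fin r) :
      leadExponent β.1 i < d₁ := by
    have h2 : ∑ t ∈ Finset.Ici i, β.1 t ≤ ∑ t, β.1 t :=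
      Finset.sum_le_sum_of_subset (Finset.subset_univ _)
    have h3 := β.2
    have h4 := i.2
    simp only [leadExponent, Finsupp.coe_equivFunOnFinite_symm]
    omega
  choose Ψ hΨB hΨI hΨε using fun β : {α : Fin r → ℕ // ∑ t, α t ≤ d₁ - r} =>
    exists_functional k h₀ h₁ fun i => ⟨leadExponent β.1 i, hlt β i⟩
  have hX (v : Fin d₀ ⊕ Fin d₁) : pairToTriple k d₀ d₁ r (MvPowerSeries.X v) =
      MvPowerSeries.X (Sum.inr v) := MvPowerSeries.rename_X _ _
  let M : Matrix {α : Fin r → ℕ // ∑ t, α t ≤ d₁ - r} {α : Fin r → ℕ // ∑ t, α t ≤ d₁ - r}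
      (CoeffRing k d₀ d₁ r) := Matrix.of fun α β => Ψ β (∏ t : Fin r,
        MvPowerSeries.X (Sum.inr (Sum.inl ⟨d₀ - r + (t : ℕ), by omega⟩)) ^ α.1 t)
  obtain ⟨S, hS, hSv⟩ := exists_leftInverse_mul_det (D := d₁ - r) (Nat.sub_add_cancel h₀) M.det
    fun C _ ε hε => by
      rw [RingHom.map_det]
      congr 1
      ext α β
      exact hΨε β C ε hε α.1
  have hdiv (v : DivRing k d₁) : divToPair k d₀ d₁ v =
      coeffToPair k d₀ d₁ r (MvPowerSeries.rename Sum.inr v) := by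
    rw [divToPair, coeffToPair, MvPowerSeries.rename_rename]
    exact rename_congr (funext fun _ => rfl) _
  -- the functionals take the values `b ᵥ* M` on the combination with coefficients `b`
  refine ⟨{ toFun := fun p α => S (∑ β, Ψ β p * M.adjugate β α)
            map_zero' := ?_
            map_add' := fun p q => ?_ }, fun p hp => ?_, fun v p α => ?_, fun b => ?_⟩
  · funext α
    simp
  · funext α
    simp [add_mul, Finset.sum_add_distrib]
  · funext α
    simp [hΨI _ p hp]
  · change S _ = _ * S _
    rw [← hSv, hdiv]
    simp only [hΨB, Finset.mul_sum, mul_assoc]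
  · funext α
    change S _ = _
    rw [← hS (b α)]
    congr 1
    have h1 (β) : Ψ β (pairToTriple k d₀ d₁ r (∑ α, coeffToPair k d₀ d₁ r (b α) *
        ∏ t : Fin r, (MvPowerSeries.X (Sum.inl ⟨d₀ - r + (t : ℕ), by omega⟩)) ^ α.1 t)) =
        Matrix.vecMul b M β := by
      simp only [map_sum, map_mul, hΨB, map_prod, map_pow, hX]
      rfl
    simp only [h1]
    change Matrix.vecMul (Matrix.vecMul b M) M.adjugate α = _
    rw [Matrix.vecMul_vecMul, Matrix.mul_adjugate, Matrix.vecMul_smul, Matrix.vecMul_one]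
    rfl

end Determinant

/-! ### The projection from triples to pairs -/

section Projection

theorem subMk_pairToTriple_eq_zero (k : Type*) [CommRing k] {d₀ d₁ r : ℕ}
    {p : DivPairRing k d₀ d₁} (hp : p ∈ intIdeal (pairPoly₀ k d₀ d₁) (pairPoly₁ k d₀ d₁) r) :
    subMk k d₀ d₁ r (pairToTriple k d₀ d₁ r p) = 0 := by
  rcases subsingleton_or_nontrivial k with hk | hk
  · have : Subsingleton (DivTripleRing k d₀ d₁ r) :=
      ⟨fun a b => by ext; exact Subsingleton.elim _ _⟩
    rw [Subsingleton.elim (pairToTriple k d₀ d₁ r p) 0, map_zero]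
  · exact Ideal.Quotient.eq_zero_iff_mem.2 (intIdeal_le_comap
      (h := triplePoly k d₀ d₁ r) (I := Ideal.span (Set.range MvPowerSeries.X))
      (monicPoly_isDistinguishedAt Sum.inl) (monicPoly_natDegree _)
      (pairToTriple k d₀ d₁ r).toRingHom le_sup_left le_sup_right hp)

end Projection

/-! ### The basis and the splitting -/

section Assembly

variable (k : Type*) [CommRing k] {d₀ d₁ r : ℕ}

theorem algebraMap_intRing_rename (v : DivRing k d₁) :
    algebraMap (CoeffRing k d₀ d₁ r) (IntRing k d₀ d₁ r) (MvPowerSeries.rename Sum.inr v) =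
      algebraMap (DivRing k d₁) (IntRing k d₀ d₁ r) v := by
  change intMk k d₀ d₁ r (coeffToPair k d₀ d₁ r (MvPowerSeries.rename Sum.inr v)) =
    intMk k d₀ d₁ r (divToPair k d₀ d₁ v)
  rw [divToPair, coeffToPair, MvPowerSeries.rename_rename]
  exact congrArg _ (rename_congr (funext fun _ => rfl) _)

theorem intMk_sum (h₀ : r ≤ d₀)
    (b : {α : Fin r → ℕ // ∑ t, α t ≤ d₁ - r} → CoeffRing k d₀ d₁ r) :
    intMk k d₀ d₁ r (∑ α, coeffToPair k d₀ d₁ r (b α) *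
      ∏ t : Fin r, (MvPowerSeries.X (Sum.inl ⟨d₀ - r + (t : ℕ), by omega⟩)) ^ α.1 t) =
    ∑ α, b α • ∏ t, topCoeff k d₁ h₀ t ^ α.1 t := by
  simp only [map_sum, map_mul, map_prod, map_pow, Algebra.smul_def]
  rfl

/-- The projection from triples to pairs, on the coordinate rings of `Int_r(d₀, d₁)` and
`Sub_r(d₀, d₁)`. -/
noncomputable def intToSub (d₀ d₁ r : ℕ) :
    IntRing k d₀ d₁ r →ₐ[DivRing k d₁] SubRing k d₀ d₁ r where
  toRingHom := Ideal.Quotient.lift _ ((subMk k d₀ d₁ r).comp (pairToTriple k d₀ d₁ r).toRingHom)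
    fun _ hp => subMk_pairToTriple_eq_zero k hp
  commutes' _ := rfl

theorem exists_intToSub_leftInverse (h₀ : r ≤ d₀) (h₁ : r ≤ d₁) :
    (∃ b : Module.Basis {α : Fin r → ℕ // ∑ t, α t ≤ d₁ - r}
        (CoeffRing k d₀ d₁ r) (IntRing k d₀ d₁ r),
      ∀ α, b α = ∏ t, topCoeff k d₁ h₀ t ^ α.1 t) ∧
    ∃ s : SubRing k d₀ d₁ r →ₗ[DivRing k d₁] IntRing k d₀ d₁ r,
      s ∘ₗ (intToSub k d₀ d₁ r).toLinearMap = LinearMap.id := by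
  obtain ⟨Φ, hΦI, hΦv, hΦ⟩ := exists_coordinates k h₀ h₁
  set mon : {α : Fin r → ℕ // ∑ t, α t ≤ d₁ - r} → IntRing k d₀ d₁ r :=
    fun α => ∏ t, topCoeff k d₁ h₀ t ^ α.1 t with hmon
  constructor
  · refine ⟨Module.Basis.mk (v := mon) ?_ ?_, fun α => Module.Basis.mk_apply _ _ α⟩
    · rw [Fintype.linearIndependent_iff]
      intro b hb α
      rw [hmon, ← intMk_sum] at hb
      have h1 : _ ∈ intIdeal (pairPoly₀ k d₀ d₁) (pairPoly₁ k d₀ d₁) r :=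
        Ideal.Quotient.eq_zero_iff_mem.1 hb
      have h2 : _ ∈ subIdeal k d₀ d₁ r :=
        Ideal.Quotient.eq_zero_iff_mem.1 (subMk_pairToTriple_eq_zero k h1)
      have h3 := hΦI _ h2
      rw [hΦ] at h3
      exact congrFun h3 α
    · rintro x -
      obtain ⟨p, rfl⟩ : ∃ p, intMk k d₀ d₁ r p = x := Ideal.Quotient.mk_surjective x
      obtain ⟨b, hb⟩ := exists_intMk_eq_sum k h₀ h₁ p
      rw [hb]
      exact Submodule.sum_mem _ fun α _ => Submodule.smul_mem _ _ (Submodule.subset_span ⟨α, rfl⟩)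
  · let g : DivTripleRing k d₀ d₁ r →+ IntRing k d₀ d₁ r :=
      { toFun := fun p => ∑ α, Φ p α • mon α
        map_zero' := by simp
        map_add' := fun p q => by simp [add_smul, Finset.sum_add_distrib] }
    -- the left inverse recombines the coordinates of a function with the monomials
    let g' : SubRing k d₀ d₁ r →+ IntRing k d₀ d₁ r :=
      QuotientAddGroup.lift (subIdeal k d₀ d₁ r).toAddSubgroup g fun p hp => by
        change ∑ α, Φ p α • mon α = 0
        simp [hΦI p hp]
    have hg' (p : DivTripleRing k d₀ d₁ r) : g' (subMk k d₀ d₁ r p) = ∑ α, Φ p α • mon α := rfl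
    refine ⟨{ g' with map_smul' := fun v x => ?_ }, ?_⟩
    · obtain ⟨p, rfl⟩ : ∃ p, subMk k d₀ d₁ r p = x := Ideal.Quotient.mk_surjective x
      have h1 : v • subMk k d₀ d₁ r p =
          subMk k d₀ d₁ r (pairToTriple k d₀ d₁ r (divToPair k d₀ d₁ v) * p) := by
        rw [Algebra.smul_def, map_mul]
        rfl
      change g' _ = v • g' _
      rw [h1, hg', hg', Finset.smul_sum]
      refine Finset.sum_congr rfl fun α _ => ?_
      rw [hΦv, mul_smul, Algebra.smul_def (MvPowerSeries.rename Sum.inr v),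
        algebraMap_intRing_rename, ← Algebra.smul_def]
    · ext x
      obtain ⟨p, rfl⟩ : ∃ p, intMk k d₀ d₁ r p = x := Ideal.Quotient.mk_surjective x
      obtain ⟨b, hb⟩ := exists_intMk_eq_sum k h₀ h₁ p
      rw [← intMk_sum] at hb
      rw [hb]
      change g' (subMk k d₀ d₁ r (pairToTriple k d₀ d₁ r _)) = _
      rw [hg', hΦ, LinearMap.id_apply, intMk_sum k h₀]

end Assembly

end DivisorIntersection

theorem mainTheorem3 (k : Type*) [CommRing k] (d₀ d₁ r : ℕ) (h₀ : r ≤ d₀) (h₁ : r ≤ d₁) :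
    (∃ b : Module.Basis {α : Fin r → ℕ // ∑ t, α t ≤ d₁ - r}
        (DivisorIntersection.CoeffRing k d₀ d₁ r) (DivisorIntersection.IntRing k d₀ d₁ r),
      ∀ α, b α = ∏ t, DivisorIntersection.topCoeff k d₁ h₀ t ^ α.1 t) ∧
    ∃ π : DivisorIntersection.IntRing k d₀ d₁ r →ₐ[DivisorIntersection.DivRing k d₁]
        DivisorIntersection.SubRing k d₀ d₁ r,
      (∀ p : DivisorIntersection.DivPairRing k d₀ d₁,
        π (DivisorIntersection.intMk k d₀ d₁ r p) =
          DivisorIntersection.subMk k d₀ d₁ r (DivisorIntersection.pairToTriple k d₀ d₁ r p)) ∧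
      (∃ s : DivisorIntersection.SubRing k d₀ d₁ r →ₗ[DivisorIntersection.DivRing k d₁]
          DivisorIntersection.IntRing k d₀ d₁ r,
        s ∘ₗ π.toLinearMap = LinearMap.id) ∧
      Function.Injective π := by
  obtain ⟨hb, s, hs⟩ := DivisorIntersection.exists_intToSub_leftInverse k h₀ h₁
  exact ⟨hb, DivisorIntersection.intToSub k d₀ d₁ r, fun _ => rfl, ⟨s, hs⟩,
    Function.LeftInverse.injective (g := s) fun x => DFunLike.congr_fun hs x⟩
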